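/- **Proposition (commutator between the heat flow and the paraproduct).** Let $d \in \mathbb{N}$ and let $C^\infty_{\mathrm{per}}$ be the space of smooth functions $\mathbb{R}^d \to \mathbb{C}$ that are $(2\mathbb{Z})^d$-periodic; write $L^p = L^p([-1,1]^d)$. Fix smooth functions $\tilde\chi, \chi : \mathbb{R}^d \to [0,1]$ with $\operatorname{supp}\tilde\chi \subset B(0,4/3)$, $\operatorname{supp}\chi \subset B(0,8/3)\setminus B(0,3/4)$ and $\tilde\chi(\zeta) + \sum_{k\ge 0}\chi(\zeta/2^k) = 1$ for all $\zeta$. Put $\chi_{-1} = \tilde\chi$, $\chi_k = \chi(\cdot/2^k)$ for $k \ge 0$, $\eta_k = \mathscr{F}^{-1}\chi_k$ where $\mathscr{F}f(\zeta) = \int e^{-ix\cdot\zeta} f(x)\,dx$, and for $f, g\in C^\infty_{\mathrm{per}}$ $$\delta_k f = \eta_k \star f, \qquad S_k f = \sum_{-1\le j<k}\delta_j f, \qquad f \prec g = \sum_{k} S_{k-1}f\,\delta_k g .$$ For $\alpha\in\mathbb{R}$ and $p\in[1,\infty]$, let $\mathcal{B}^\alpha_{p,\infty}$ be the completion of $C^\infty_{\mathrm{per}}$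 with respect to the norm $\|f\|_{\mathcal{B}^\alpha_{p,\infty}} = \sup_{k\ge -1} 2^{\alpha k}\|\delta_k f\|_{L^p}$. For $t>0$, let $e^{t\Delta}f$ be the convolution of $f$ with $y \mapsto (4\pi t)^{-d/2}e^{-|y|^2/(4t)}$. Let $\alpha<1$, $\beta\in\mathbb{R}$, $\gamma\ge\alpha+\beta$, and let $p,p_1,p_2\in[1,\infty]$ be such that $1/p = 1/p_1+1/p_2$. For $f,g \in C^\infty_{\mathrm{per}}$, the series that defines $f\prec g$ converges absolutely at every point, and $f \prec g$ and $e^{t\Delta}g$ ($t > 0$) belong to $C^\infty_{\mathrm{per}}$. There exists $C<\infty$ (not depending on $t$, $f$, $g$) such that for every $t>0$ the map $$[e^{t\Delta},\prec] : (f,g)\mapsto e^{t\Delta}(f\prec g) - f\prec(e^{t\Delta}g), \qquad f,g\in C^\infty_{\mathrm{per}},$$ extends to a continuous bilinear map from $\mathcal{B}^\alpha_{p_1,\infty}\times\mathcal{B}^\beta_{p_2,\infty}$ to $\mathcal{B}^\gamma_{p,\infty}$, and this extension satisfies, for all $f\in \mathcal{B}^\alpha_{p_1,\infty}$ and $g\in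 \mathcal{B}^\beta_{p_2,\infty}$, $$\|[e^{t\Delta},\prec](f,g)\|_{\mathcal{B}^\gamma_{p,\infty}} \le C\,t^{\frac{\alpha+\beta-\gamma}{2}}\,\|f\|_{\mathcal{B}^\alpha_{p_1,\infty}}\,\|g\|_{\mathcal{B}^\beta_{p_2,\infty}} .$$ -/

import Mathlib

open MeasureTheory
open scoped ENNReal ContDiff FourierTransform SchwartzMap LineDeriv

noncomputable section

namespace TorusBesov

/-! ### Smooth periodic functions -/

/-- The Euclidean space `ℝ^d`. -/
abbrev Space (d : ℕ) := EuclideanSpace ℝ (Fin d)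

/-- The vector of the lattice `(2ℤ)^d` with coordinates `2 n i`. -/
def latticeVec {d : ℕ} (n : Fin d → ℤ) : Space d := WithLp.toLp 2 fun i => 2 * (n i : ℝ)

/-- The period cell `[-1,1]^d`. -/
def cell (d : ℕ) : Set (Space d) := {x | ∀ i, x i ∈ Set.Icc (-1 : ℝ) 1}

/-- The space of smooth functions `ℝ^d → ℂ` which are periodic with respect to `(2ℤ)^d`, that is,
of smooth functions on the torus `[-1,1]^d`. -/
def SmoothPer (d : ℕ) : Submodule ℂ (Space d → ℂ) where
  carrier := {f | ContDiff ℝ ∞ f ∧ ∀ (n : Fin d → ℤ) (x : Space d), f (x + latticeVec n) = f x}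
  add_mem' := by
    rintro f g ⟨hf, hf'⟩ ⟨hg, hg'⟩
    exact ⟨hf.add hg, fun n x => by simp [hf', hg']⟩
  zero_mem' := ⟨contDiff_const, fun _ _ => rfl⟩
  smul_mem' := by
    rintro c f ⟨hf, hf'⟩
    exact ⟨contDiff_const.smul hf, fun n x => by simp [hf']⟩

/-! ### Littlewood-Paley blocks -/

/-- A dyadic partition of unity on `ℝ^d`: `low` plays the role of `χ̃` and `bump` that of `χ`. -/
structure DyadicPartition (d : ℕ) where
  low : Space d → ℝ
  bump : Space d → ℝ
  low_smooth : ContDiff ℝ ∞ low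
  bump_smooth : ContDiff ℝ ∞ bump
  low_mem : ∀ ζ, low ζ ∈ Set.Icc (0 : ℝ) 1
  bump_mem : ∀ ζ, bump ζ ∈ Set.Icc (0 : ℝ) 1
  low_supp : tsupport low ⊆ Metric.ball 0 (4 / 3)
  bump_supp : tsupport bump ⊆ Metric.ball 0 (8 / 3) \ Metric.ball 0 (3 / 4)
  sum_eq_one : ∀ ζ, HasSum (fun k : ℕ => bump (((2 : ℝ) ^ k)⁻¹ • ζ)) (1 - low ζ)

/-- Dyadic partitions of unity exist. -/
instance {d : ℕ} : Nonempty (DyadicPartition d) := by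
  let b : ContDiffBump (0 : Space d) := ⟨3 / 4, 5 / 4, by norm_num, by norm_num⟩
  have hn : ∀ ζ : Space d, ‖(2 : ℝ)⁻¹ • ζ‖ = ‖ζ‖ / 2 := fun ζ => by
    rw [norm_smul]; norm_num; ring
  have h1 : ∀ ζ : Space d, ‖ζ‖ ≤ 3 / 4 → b ζ = 1 := fun ζ h =>
    b.one_of_mem_closedBall (by simpa using h)
  have h0 : ∀ ζ : Space d, 5 / 4 ≤ ‖ζ‖ → b ζ = 0 := fun ζ h =>
    b.zero_of_le_dist (by simpa using h)
  have hmem : ∀ ζ : Space d, b ((2 : ℝ)⁻¹ • ζ) - b ζ ∈ Set.Icc (0 : ℝ) 1 := by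
    intro ζ
    refine ⟨?_, by linarith [b.nonneg (x := ζ), b.le_one (x := (2 : ℝ)⁻¹ • ζ)]⟩
    rcases le_total ‖ζ‖ (3 / 2) with h | h
    · rw [h1 ((2 : ℝ)⁻¹ • ζ) (by rw [hn]; linarith)]
      linarith [b.le_one (x := ζ)]
    · rw [h0 ζ (by linarith)]
      linarith [b.nonneg (x := (2 : ℝ)⁻¹ • ζ)]
  refine ⟨⟨b, fun ζ => b ((2 : ℝ)⁻¹ • ζ) - b ζ, b.contDiff,
    (b.contDiff.comp (contDiff_const_smul _)).sub b.contDiff,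
    fun ζ => ⟨b.nonneg, b.le_one⟩, hmem, ?_, ?_, ?_⟩⟩
  · rw [b.tsupport_eq]
    exact Metric.closedBall_subset_ball (by norm_num)
  · have : tsupport (fun ζ => b ((2 : ℝ)⁻¹ • ζ) - b ζ) ⊆
        Metric.closedBall 0 (5 / 2) ∩ (Metric.ball 0 (3 / 4))ᶜ := by
      refine closure_minimal (fun ζ hζ => ?_)
        (Metric.isClosed_closedBall.inter Metric.isOpen_ball.isClosed_compl)
      rw [Function.mem_support] at hζ
      simp only [Set.mem_inter_iff, Set.mem_compl_iff, mem_closedBall_zero_iff,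
        mem_ball_zero_iff, not_lt]
      constructor
      · by_contra! h
        exact hζ (by rw [h0 ζ (by linarith), h0 _ (by rw [hn]; linarith), sub_zero])
      · by_contra! h
        exact hζ (by rw [h1 ζ h.le, h1 _ (by rw [hn]; linarith [norm_nonneg ζ]), sub_self])
    exact fun ζ hζ => ⟨Metric.closedBall_subset_ball (by norm_num) (this hζ).1, (this hζ).2⟩
  · intro ζ
    rw [hasSum_iff_tendsto_nat_of_nonneg fun k => (hmem _).1]
    have hs : ∀ n : ℕ, ∑ k ∈ Finset.range n, (b ((2 : ℝ)⁻¹ • (((2 : ℝ) ^ k)⁻¹ • ζ)) -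
        b (((2 : ℝ) ^ k)⁻¹ • ζ)) = b (((2 : ℝ) ^ n)⁻¹ • ζ) - b ζ := by
      intro n
      have e := Finset.sum_range_sub (fun k : ℕ => b (((2 : ℝ) ^ k)⁻¹ • ζ)) n
      simp only [pow_zero, inv_one, one_smul] at e
      rw [← e]
      refine Finset.sum_congr rfl fun k _ => ?_
      rw [smul_smul, pow_succ, mul_inv_rev]
    simp only [hs]
    refine Filter.Tendsto.sub_const ?_ _
    have ht : Filter.Tendsto (fun n : ℕ => ((2 : ℝ) ^ n)⁻¹ • ζ) Filter.atTop (nhds 0) := by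
      have := (tendsto_inv_atTop_zero.comp
        (tendsto_pow_atTop_atTop_of_one_lt (one_lt_two (α := ℝ)))).smul_const ζ
      simpa using this
    have := (b.continuous.tendsto 0).comp ht
    rwa [h1 0 (by rw [norm_zero]; norm_num)] at this

/-- The symbol `χ_k`: `χ_{-1} = χ̃`, and `χ_k = χ(·/2^k)` for `k ≥ 0`.
Only indices `k ≥ -1` are ever used. -/
def symbol {d : ℕ} (P : DyadicPartition d) (k : ℤ) (ζ : Space d) : ℝ :=
  if k = -1 then P.low ζ else P.bump (((2 : ℝ) ^ k)⁻¹ • ζ)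

/-- The kernel `η_k = ℱ⁻¹ χ_k`, for the Fourier transform
`ℱ f(ζ) = ∫ e^{-i x·ζ} f(x) dx`. -/
def kernel {d : ℕ} (P : DyadicPartition d) (k : ℤ) (x : Space d) : ℂ :=
  (((2 * Real.pi) ^ d : ℝ) : ℂ)⁻¹ *
    ∫ ζ : Space d, Complex.exp (Complex.I * (inner ℝ x ζ : ℝ)) * (symbol P k ζ : ℂ)

/-- The Littlewood-Paley block `δ_k f = ℱ⁻¹ (χ_k ℱ f) = η_k ⋆ f`. -/
def block {d : ℕ} (P : DyadicPartition d) (k : ℤ) (f : Space d → ℂ) (x : Space d) : ℂ :=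
  ∫ y : Space d, kernel P k y * f (x - y)

/-- The partial sum `S_k f = ∑_{-1 ≤ j < k} δ_j f`. -/
def lowPart {d : ℕ} (P : DyadicPartition d) (k : ℤ) (f : Space d → ℂ) (x : Space d) : ℂ :=
  ∑ j ∈ Finset.Ico (-1) k, block P j f x

/-- The paraproduct `f ≺ g = ∑_k S_{k-1} f δ_k g` (the terms with `k ≤ 0` vanish, the sum that
defines `S_{k-1} f` being empty). -/
def paraproduct {d : ℕ} (P : DyadicPartition d) (f g : Space d → ℂ) (x : Space d) : ℂ :=
  ∑' k : ℤ, lowPart P (k - 1) f x * block P k g x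

/-- The heat semigroup `e^{tΔ} f` for `t > 0`, the convolution of `f` with the Gaussian kernel
`(4πt)^{-d/2} e^{-|y|²/(4t)}`. -/
def heat {d : ℕ} (t : ℝ) (f : Space d → ℂ) (x : Space d) : ℂ :=
  ∫ y : Space d,
    (((4 * Real.pi * t) ^ (-(d : ℝ) / 2) * Real.exp (-‖y‖ ^ 2 / (4 * t)) : ℝ) : ℂ) * f (x - y)

/-- The commutator `[e^{tΔ}, ≺](f, g) = e^{tΔ}(f ≺ g) - f ≺ (e^{tΔ} g)`. -/
def heatCommutator {d : ℕ} (P : DyadicPartition d) (t : ℝ) (f g : Space d → ℂ) : Space d → ℂ :=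
  heat t (paraproduct P f g) - paraproduct P f (heat t g)

/-- The Besov norm `sup_{k ≥ -1} 2^{αk} ‖δ_k f‖_{L^p([-1,1]^d)}`, with values in `[0,∞]`. -/
def besovENorm {d : ℕ} (P : DyadicPartition d) (α : ℝ) (p : ℝ≥0∞) (f : Space d → ℂ) : ℝ≥0∞ :=
  ⨆ (k : ℤ) (_ : -1 ≤ k),
    ENNReal.ofReal ((2 : ℝ) ^ (α * k)) * eLpNorm (block P k f) p (volume.restrict (cell d))

/-! ### The Besov norm is a finite seminorm on smooth periodic functions -/

section Aux

variable {d : ℕ}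

lemma isCompact_cell : IsCompact (cell d) := by
  have h : cell d = (EuclideanSpace.equiv (Fin d) ℝ).toHomeomorph ⁻¹'
      (Set.univ.pi fun _ => Set.Icc (-1 : ℝ) 1) := by
    ext x
    simp only [cell, Set.mem_ofPred_eq, Set.mem_preimage, Set.mem_univ_pi]
    rfl
  rw [h, Homeomorph.isCompact_preimage]
  exact isCompact_univ_pi fun _ => isCompact_Icc

lemma exists_bound (f : SmoothPer d) : ∃ C, ∀ x, ‖(f : Space d → ℂ) x‖ ≤ C := by
  obtain ⟨f, hf, hper⟩ := f
  obtain ⟨C, hC⟩ := isCompact_cell.exists_bound_of_continuousOn (hf.continuous.continuousOn)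
  refine ⟨C, fun x => ?_⟩
  have h := hper (fun i => -round (x i / 2)) x
  simp only
  rw [← h]
  apply hC
  intro i
  have h2 := abs_sub_round (x i / 2)
  rw [abs_le] at h2
  simp only [latticeVec, PiLp.add_apply, Set.mem_Icc]
  push_cast
  constructor <;> linarith [h2.1, h2.2]

/-- Directional derivatives preserve smooth periodic functions. -/
def dirDeriv (v : Space d) (f : SmoothPer d) : SmoothPer d :=
  ⟨fun x => fderiv ℝ (f : Space d → ℂ) x v, by
    obtain ⟨f, hf, hper⟩ := f
    refine ⟨?_, fun n x => ?_⟩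
    · exact (hf.fderiv_right (m := ∞) (by simp)).clm_apply contDiff_const
    · have : (fun y => f (y + latticeVec n)) = f := funext (hper n)
      simp only
      rw [← fderiv_comp_add_right, this]⟩

lemma integrable_schwartz_mul (ψ : 𝓢(Space d, ℂ)) (f : SmoothPer d) (s : ℝ) (x : Space d) :
    Integrable fun w => ψ w * (f : Space d → ℂ) (x - s • w) := by
  obtain ⟨C, hC⟩ := exists_bound f
  have hc : Continuous (f : Space d → ℂ) := f.2.1.continuous
  refine ψ.integrable.mul_bdd (c := C) ?_ (Filter.Eventually.of_forall fun w => hC _)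
  exact (hc.comp (by fun_prop)).aestronglyMeasurable

lemma exists_bound_zero (ψ : 𝓢(Space d, ℂ)) (f : SmoothPer d) :
    ∃ C, ∀ (s : ℝ) (x : Space d), ‖∫ w, ψ w * (f : Space d → ℂ) (x - s • w)‖ ≤ C := by
  obtain ⟨C, hC⟩ := exists_bound f
  refine ⟨∫ w, ‖ψ w‖ * C, fun s x => ?_⟩
  refine norm_integral_le_of_norm_le (ψ.integrable.norm.mul_const C)
    (Filter.Eventually.of_forall fun w => ?_)
  rw [norm_mul]
  exact mul_le_mul_of_nonneg_left (hC _) (norm_nonneg _)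

lemma integral_lineDeriv (φ : 𝓢(Space d, ℂ)) (f : SmoothPer d) (v : Space d) (s : ℝ)
    (x : Space d) :
    ∫ w, (∂_{v} φ) w * (f : Space d → ℂ) (x - s • w) =
      (s : ℂ) * ∫ w, φ w * (dirDeriv v f : Space d → ℂ) (x - s • w) := by
  have hd : ∀ w, HasFDerivAt (fun w => (f : Space d → ℂ) (x - s • w))
      ((fderiv ℝ (f : Space d → ℂ) (x - s • w)).comp (-(s • ContinuousLinearMap.id ℝ (Space d))))
      w := by
    intro w
    have h1 : HasFDerivAt (f : Space d → ℂ) _ (x - s • w) :=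
      (f.2.1.differentiable (by simp) _).hasFDerivAt
    exact h1.comp w (((hasFDerivAt_id w).const_smul s).const_sub x)
  have hfd : ∀ w, fderiv ℝ (fun w => (f : Space d → ℂ) (x - s • w)) w v
      = -((s : ℂ) * (dirDeriv v f : Space d → ℂ) (x - s • w)) := by
    intro w
    rw [(hd w).fderiv]
    simp [dirDeriv]
  have hi1 := integrable_schwartz_mul (∂_{v} φ) f s x
  have hi2 := integrable_schwartz_mul φ (dirDeriv v f) s x
  have hi3 := integrable_schwartz_mul φ f s x
  have key := integral_mul_fderiv_eq_neg_fderiv_mul_of_integrable (μ := volume)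
    (f := (φ : Space d → ℂ)) (g := fun w => (f : Space d → ℂ) (x - s • w)) (v := v)
    (by simpa [SchwartzMap.lineDerivOp_apply_eq_fderiv] using hi1)
    (by
      simp only [hfd]
      refine (hi2.const_mul (-(s : ℂ))).congr (Filter.Eventually.of_forall fun w => ?_)
      simp only
      ring)
    hi3 (fun w _ => φ.differentiableAt) (fun w _ => (hd w).differentiableAt)
  simp only [hfd] at key
  simp only [SchwartzMap.lineDerivOp_apply_eq_fderiv]
  rw [← integral_const_mul, ← neg_eq_iff_eq_neg.mpr key, ← integral_neg]
  congr 1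
  ext w
  ring

/-- Dividing the symbol by a linear form: a smooth symbol supported away from the origin is
a sum of derivatives on the physical side. -/
lemma exists_decomp (g : 𝓢(Space d, ℂ)) (hg : HasCompactSupport g)
    (h0 : (0 : Space d) ∉ tsupport g) :
    ∃ G : Fin d → 𝓢(Space d, ℂ),
      (∀ i, HasCompactSupport (G i) ∧ (0 : Space d) ∉ tsupport (G i)) ∧
      𝓕⁻ g = ∑ i, ∂_{EuclideanSpace.single i (1 : ℝ)} (𝓕⁻ (G i)) := by
  let m : Fin d → Space d → ℂ := fun i ξ =>
    ((ξ i : ℂ) * ((2 * Real.pi * Complex.I) * ((‖ξ‖ ^ 2 : ℝ) : ℂ))⁻¹)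
  have hpi : (2 * Real.pi * Complex.I : ℂ) ≠ 0 := by
    simp [Real.pi_ne_zero]
  have hsm : ∀ i, ContDiff ℝ ∞ (fun ξ => m i ξ * g ξ) := by
    intro i
    rw [contDiff_iff_contDiffAt]
    intro ξ
    by_cases hξ : ξ = 0
    · subst hξ
      have : (fun ξ => m i ξ * g ξ) =ᶠ[nhds 0] fun _ => 0 := by
        filter_upwards [notMem_tsupport_iff_eventuallyEq.mp h0] with ξ hξ
        simp [hξ]
      exact contDiffAt_const.congr_of_eventuallyEq this
    · refine ContDiffAt.mul (ContDiffAt.mul ?_ (ContDiffAt.inv ?_ ?_)) (g.smooth ⊤).contDiffAt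
      · exact Complex.ofRealCLM.contDiff.contDiffAt.comp ξ
          (EuclideanSpace.proj (𝕜 := ℝ) i).contDiff.contDiffAt
      · exact contDiffAt_const.mul
          (Complex.ofRealCLM.contDiff.contDiffAt.comp ξ (contDiff_norm_sq ℝ).contDiffAt)
      · refine mul_ne_zero hpi ?_
        simpa using hξ
  have hcs : ∀ i, HasCompactSupport (fun ξ => m i ξ * g ξ) := fun i => hg.mul_left
  refine ⟨fun i => (hcs i).toSchwartzMap (hsm i), fun i => ⟨hcs i, ?_⟩, ?_⟩
  · exact fun h => h0 (tsupport_mul_subset_right h)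
  · have hsum : g = ∑ i, (2 * Real.pi * Complex.I) •
        SchwartzMap.smulLeftCLM ℂ (inner ℝ · (EuclideanSpace.single i (1 : ℝ)))
          ((hcs i).toSchwartzMap (hsm i)) := by
      ext ξ
      have ht : ∀ i : Fin d, (fun x : Space d =>
          inner ℝ x (EuclideanSpace.single i (1 : ℝ))).HasTemperateGrowth := fun i => by fun_prop
      simp only [sum_apply, smul_apply,
        SchwartzMap.smulLeftCLM_apply_apply (ht _)]
      by_cases hξ : ξ = 0
      · subst hξ
        have : g 0 = 0 := image_eq_zero_of_notMem_tsupport h0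
        simp [this]
      · have hn : ((‖ξ‖ ^ 2 : ℝ) : ℂ) ≠ 0 := by simpa using hξ
        have e : ∀ i : Fin d, (2 * Real.pi * Complex.I) •
            (inner ℝ ξ (EuclideanSpace.single i (1 : ℝ))) •
              ((hcs i).toSchwartzMap (hsm i)) ξ
            = (((ξ i) ^ 2 : ℝ) : ℂ) * (((‖ξ‖ ^ 2 : ℝ) : ℂ)⁻¹ * g ξ) := by
          intro i
          have : ((hcs i).toSchwartzMap (hsm i)) ξ = m i ξ * g ξ := rfl
          rw [this]
          simp only [m, EuclideanSpace.inner_single_right, smul_eq_mul, Complex.real_smul]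
          push_cast
          simp only [one_mul, conj_trivial]
          field_simp
        rw [Finset.sum_congr rfl fun i _ => e i, ← Finset.sum_mul, ← Complex.ofReal_sum,
          ← EuclideanSpace.real_norm_sq_eq]
        rw [← mul_assoc, mul_inv_cancel₀ hn, one_mul]
    conv_lhs => rw [hsum]
    simp only [SchwartzMap.lineDerivOp_fourierInv_eq]
    exact map_sum (FourierTransform.fourierInvCLM ℂ 𝓢(Space d, ℂ)) _ _

lemma exists_bound_pow (m : ℕ) : ∀ (g : 𝓢(Space d, ℂ)), HasCompactSupport g →
    (0 : Space d) ∉ tsupport g → ∀ f : SmoothPer d, ∃ C, ∀ (s : ℝ), 0 ≤ s → ∀ x : Space d,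
      ‖∫ w, (𝓕⁻ g) w * (f : Space d → ℂ) (x - s • w)‖ ≤ C * s ^ m := by
  induction m with
  | zero =>
    intro g _ _ f
    obtain ⟨C, hC⟩ := exists_bound_zero (𝓕⁻ g) f
    exact ⟨C, fun s _ x => by simpa using hC s x⟩
  | succ m ih =>
    intro g hg h0 f
    obtain ⟨G, hG, hsum⟩ := exists_decomp g hg h0
    choose C hC using fun i =>
      ih (G i) (hG i).1 (hG i).2 (dirDeriv (EuclideanSpace.single i (1 : ℝ)) f)
    refine ⟨∑ i, C i, fun s hs x => ?_⟩
    have h1 : ∫ w, (𝓕⁻ g) w * (f : Space d → ℂ) (x - s • w) = ∑ i, (s : ℂ) *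
        ∫ w, (𝓕⁻ (G i)) w *
          (dirDeriv (EuclideanSpace.single i (1 : ℝ)) f : Space d → ℂ) (x - s • w) := by
      simp only [← integral_lineDeriv]
      rw [hsum, ← integral_finsetSum _ fun i _ => integrable_schwartz_mul _ f s x]
      simp [sum_apply, Finset.sum_mul]
    rw [h1, Finset.sum_mul]
    refine (norm_sum_le _ _).trans (Finset.sum_le_sum fun i _ => ?_)
    rw [norm_mul, Complex.norm_real, Real.norm_of_nonneg hs, pow_succ]
    calc s * _ ≤ s * (C i * s ^ m) := mul_le_mul_of_nonneg_left (hC i s hs x) hs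
      _ = _ := by ring

lemma hasCompactSupport_low (P : DyadicPartition d) :
    HasCompactSupport (fun ζ => (P.low ζ : ℂ)) := by
  have : HasCompactSupport P.low := by
    refine (isCompact_closedBall (0 : Space d) (4 / 3)).of_isClosed_subset
      (isClosed_tsupport _) (P.low_supp.trans Metric.ball_subset_closedBall)
  exact this.comp_left Complex.ofReal_zero

lemma hasCompactSupport_bump (P : DyadicPartition d) :
    HasCompactSupport (fun ζ => (P.bump ζ : ℂ)) := by
  have : HasCompactSupport P.bump := by
    refine (isCompact_closedBall (0 : Space d) (8 / 3)).of_isClosed_subset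
      (isClosed_tsupport _) ((P.bump_supp.trans Set.sdiff_subset).trans Metric.ball_subset_closedBall)
  exact this.comp_left Complex.ofReal_zero

/-- `χ̃` as a Schwartz function. -/
def lowSchwartz (P : DyadicPartition d) : 𝓢(Space d, ℂ) :=
  (hasCompactSupport_low P).toSchwartzMap (Complex.ofRealCLM.contDiff.comp P.low_smooth)

/-- `χ` as a Schwartz function. -/
def bumpSchwartz (P : DyadicPartition d) : 𝓢(Space d, ℂ) :=
  (hasCompactSupport_bump P).toSchwartzMap (Complex.ofRealCLM.contDiff.comp P.bump_smooth)

lemma block_eq_aux (P : DyadicPartition d) (k : ℤ) (g : 𝓢(Space d, ℂ)) (l : ℝ) (hl : 0 < l)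
    (h : ∀ ζ, (symbol P k ζ : ℂ) = g (l⁻¹ • ζ)) (f : Space d → ℂ) (x : Space d) :
    block P k f x = ∫ w, (𝓕⁻ g) w * f (x - (2 * Real.pi / l) • w) := by
  have hp : (0 : ℝ) < 2 * Real.pi := by positivity
  have hk : ∀ y, kernel P k y =
      (((l / (2 * Real.pi)) ^ d : ℝ) : ℂ) * (𝓕⁻ g) ((l / (2 * Real.pi)) • y) := by
    intro y
    rw [kernel, SchwartzMap.fourierInv_coe, Real.fourierInv_eq']
    have e := Measure.integral_comp_inv_smul_of_nonneg (μ := (volume : Measure (Space d)))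
      (fun ζ => Complex.exp (Complex.I * (inner ℝ y (l • ζ) : ℝ)) * g ζ) hl.le
    simp only [smul_inv_smul₀ hl.ne'] at e
    simp only [h]
    rw [e, finrank_euclideanSpace_fin, div_pow]
    rw [Complex.real_smul]
    push_cast
    rw [← mul_assoc]
    congr 1
    · field_simp
    · congr 1
      ext ζ
      rw [smul_eq_mul]
      congr 2
      simp only [inner_smul_right, real_inner_comm]
      push_cast
      have : (Real.pi : ℂ) ≠ 0 := by simp [Real.pi_ne_zero]
      field_simp
  have hr : (0 : ℝ) < l / (2 * Real.pi) := by positivity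
  have e := Measure.integral_comp_smul_of_nonneg (μ := (volume : Measure (Space d)))
      (fun w => (𝓕⁻ g) w * f (x - (2 * Real.pi / l) • w)) (l / (2 * Real.pi)) (hR := hr.le)
  have hinv : (2 * Real.pi / l) = (l / (2 * Real.pi))⁻¹ := by rw [inv_div]
  rw [finrank_euclideanSpace_fin] at e
  simp only [block, hk]
  simp only [mul_assoc, integral_const_mul]
  rw [hinv] at e ⊢
  simp only [inv_smul_smul₀ hr.ne'] at e
  rw [e, Complex.real_smul, ← mul_assoc, ← Complex.ofReal_mul,
    mul_inv_cancel₀ (pow_ne_zero _ hr.ne')]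
  simp

lemma block_neg_one (P : DyadicPartition d) (f : Space d → ℂ) (x : Space d) :
    block P (-1) f x = ∫ w, (𝓕⁻ (lowSchwartz P)) w * f (x - (2 * Real.pi / 1) • w) :=
  block_eq_aux P (-1) (lowSchwartz P) 1 one_pos
    (fun ζ => by simp [symbol]; rfl) f x

lemma block_of_ne (P : DyadicPartition d) {k : ℤ} (hk : k ≠ -1) (f : Space d → ℂ) (x : Space d) :
    block P k f x =
      ∫ w, (𝓕⁻ (bumpSchwartz P)) w * f (x - (2 * Real.pi / (2 : ℝ) ^ k) • w) :=
  block_eq_aux P k (bumpSchwartz P) ((2 : ℝ) ^ k) (by positivity)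
    (fun ζ => by simp [symbol, hk]; rfl) f x

lemma block_eq (P : DyadicPartition d) (k : ℤ) : ∃ (ψ : 𝓢(Space d, ℂ)) (s : ℝ),
    ∀ (f : Space d → ℂ) (x : Space d), block P k f x = ∫ w, ψ w * f (x - s • w) := by
  by_cases hk : k = -1
  · subst hk
    exact ⟨_, _, block_neg_one P⟩
  · exact ⟨_, _, block_of_ne P hk⟩

lemma continuous_block (P : DyadicPartition d) (k : ℤ) (f : SmoothPer d) :
    Continuous (block P k f) := by
  obtain ⟨ψ, s, h⟩ := block_eq P k
  obtain ⟨C, hC⟩ := exists_bound f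
  have hc : Continuous (f : Space d → ℂ) := f.2.1.continuous
  rw [show block P k f = _ from funext (h f)]
  refine continuous_of_dominated (bound := fun w => ‖ψ w‖ * C)
    (fun x => (integrable_schwartz_mul ψ f s x).aestronglyMeasurable)
    (fun x => Filter.Eventually.of_forall fun w => ?_) (ψ.integrable.norm.mul_const C)
    (Filter.Eventually.of_forall fun w => by fun_prop)
  rw [norm_mul]
  exact mul_le_mul_of_nonneg_left (hC _) (norm_nonneg _)

lemma block_add (P : DyadicPartition d) (k : ℤ) (f g : SmoothPer d) :
    block P k ((f + g : SmoothPer d) : Space d → ℂ) = block P k f + block P k g := by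
  obtain ⟨ψ, s, h⟩ := block_eq P k
  ext x
  simp only [Pi.add_apply, h]
  rw [← integral_add (integrable_schwartz_mul ψ f s x) (integrable_schwartz_mul ψ g s x)]
  simp [mul_add]

lemma block_smul (P : DyadicPartition d) (k : ℤ) (c : ℂ) (f : SmoothPer d) :
    block P k ((c • f : SmoothPer d) : Space d → ℂ) = c • block P k f := by
  ext x
  simp only [block, Pi.smul_apply, smul_eq_mul, ← integral_const_mul]
  congr 1
  ext y
  simp
  ring

lemma exists_block_bound (P : DyadicPartition d) (α : ℝ) (f : SmoothPer d) :
    ∃ C, ∀ k : ℤ, -1 ≤ k → ∀ x, (2 : ℝ) ^ (α * k) * ‖block P k f x‖ ≤ C := by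
  obtain ⟨C₁, hC₁⟩ := exists_bound_zero (𝓕⁻ (lowSchwartz P)) f
  obtain ⟨m, hm⟩ := exists_nat_ge α
  have h0 : (0 : Space d) ∉ tsupport (bumpSchwartz P) := by
    intro h
    have h1 : tsupport (bumpSchwartz P) ⊆ tsupport P.bump :=
      closure_mono (Function.support_comp_subset Complex.ofReal_zero P.bump)
    have := (P.bump_supp (h1 h)).2
    simp at this
  obtain ⟨C₂, hC₂⟩ := exists_bound_pow m (bumpSchwartz P) (hasCompactSupport_bump P) h0 f
  refine ⟨max ((2 : ℝ) ^ (-α) * C₁) (C₂ * (2 * Real.pi) ^ m), fun k hk x => ?_⟩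
  by_cases hk1 : k = -1
  · subst hk1
    refine le_max_of_le_left ?_
    rw [block_neg_one]
    simp only [Int.cast_neg, Int.cast_one, mul_neg, mul_one]
    exact mul_le_mul_of_nonneg_left (hC₁ _ x) (by positivity)
  · refine le_max_of_le_right ?_
    have hk0 : 0 ≤ k := by omega
    obtain ⟨n, rfl⟩ := Int.eq_ofNat_of_zero_le hk0
    have hb := hC₂ (2 * Real.pi / (2 : ℝ) ^ (n : ℤ)) (by positivity) x
    rw [← block_of_ne P hk1] at hb
    have hC₂0 : 0 ≤ C₂ := by
      have := (norm_nonneg _).trans (hC₂ 1 zero_le_one x)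
      simpa using this
    have h2 : (2 : ℝ) ^ (α * ((n : ℤ) : ℝ)) ≤ ((2 : ℝ) ^ n) ^ m := by
      rw [← pow_mul, ← Real.rpow_natCast]
      refine Real.rpow_le_rpow_of_exponent_le one_le_two ?_
      push_cast
      rw [mul_comm]
      exact mul_le_mul_of_nonneg_left hm (Nat.cast_nonneg n)
    calc _ ≤ ((2 : ℝ) ^ n) ^ m * (C₂ * (2 * Real.pi / (2 : ℝ) ^ (n : ℤ)) ^ m) :=
          mul_le_mul h2 hb (norm_nonneg _) (by positivity)
      _ = C₂ * (2 * Real.pi) ^ m := by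
          rw [zpow_natCast, div_pow]
          field_simp

lemma besovENorm_lt_top (P : DyadicPartition d) (α : ℝ) (p : ℝ≥0∞) (f : SmoothPer d) :
    besovENorm P α p f < ⊤ := by
  obtain ⟨C, hC⟩ := exists_block_bound P α f
  have hfin : volume (cell d) < ⊤ := isCompact_cell.measure_lt_top
  have : IsFiniteMeasure ((volume : Measure (Space d)).restrict (cell d)) :=
    isFiniteMeasure_restrict.mpr hfin.ne
  refine lt_of_le_of_lt (b := (volume.restrict (cell d)) Set.univ ^ p.toReal⁻¹ *
    ENNReal.ofReal C) ?_ ?_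
  · refine iSup₂_le fun k hk => ?_
    have e : ENNReal.ofReal ((2 : ℝ) ^ (α * k)) * eLpNorm (block P k f) p
        (volume.restrict (cell d)) =
        eLpNorm (((2 : ℝ) ^ (α * k)) • block P k f) p (volume.restrict (cell d)) := by
      rw [eLpNorm_const_smul, Real.enorm_eq_ofReal (by positivity)]
    rw [e]
    refine eLpNorm_le_of_ae_bound (Filter.Eventually.of_forall fun x => ?_)
    rw [Pi.smul_apply, norm_smul, Real.norm_of_nonneg (by positivity)]
    exact hC k hk x
  · exact ENNReal.mul_lt_top (ENNReal.rpow_lt_top_of_nonneg (by positivity)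
      (measure_ne_top _ _)) ENNReal.ofReal_lt_top

lemma besovENorm_add_le (P : DyadicPartition d) (α : ℝ) (p : ℝ≥0∞) (hp : 1 ≤ p)
    (f g : SmoothPer d) :
    besovENorm P α p ((f + g : SmoothPer d) : Space d → ℂ) ≤
      besovENorm P α p f + besovENorm P α p g := by
  refine iSup₂_le fun k hk => ?_
  rw [block_add]
  refine (mul_le_mul_right (eLpNorm_add_le (continuous_block P k f).aestronglyMeasurable
    (continuous_block P k g).aestronglyMeasurable hp) _).trans ?_
  rw [mul_add]
  exact add_le_add
    (le_iSup₂ (f := fun (k : ℤ) (_ : -1 ≤ k) => ENNReal.ofReal ((2 : ℝ) ^ (α * k)) *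
      eLpNorm (block P k f) p (volume.restrict (cell d))) k hk)
    (le_iSup₂ (f := fun (k : ℤ) (_ : -1 ≤ k) => ENNReal.ofReal ((2 : ℝ) ^ (α * k)) *
      eLpNorm (block P k g) p (volume.restrict (cell d))) k hk)

lemma besovENorm_smul (P : DyadicPartition d) (α : ℝ) (p : ℝ≥0∞) (c : ℂ) (f : SmoothPer d) :
    besovENorm P α p ((c • f : SmoothPer d) : Space d → ℂ) = ‖c‖ₑ * besovENorm P α p f := by
  simp only [besovENorm, block_smul, eLpNorm_const_smul, ENNReal.mul_iSup]
  refine iSup_congr fun k => iSup_congr fun _ => ?_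
  rw [mul_left_comm]

end Aux

/-! ### Besov spaces -/

/-- The space of smooth periodic functions, to be equipped with the norm of `B^α_{p,∞}`. -/
def SmoothBesov {d : ℕ} (_P : DyadicPartition d) (_α : ℝ) (_p : ℝ≥0∞) : Type := SmoothPer d

instance {d : ℕ} (P : DyadicPartition d) (α : ℝ) (p : ℝ≥0∞) : AddCommGroup (SmoothBesov P α p) :=
  inferInstanceAs (AddCommGroup (SmoothPer d))

instance {d : ℕ} (P : DyadicPartition d) (α : ℝ) (p : ℝ≥0∞) : Module ℂ (SmoothBesov P α p) :=
  inferInstanceAs (Module ℂ (SmoothPer d))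

instance {d : ℕ} (P : DyadicPartition d) (α : ℝ) (p : ℝ≥0∞) : Norm (SmoothBesov P α p) where
  norm f := (besovENorm P α p (f : SmoothPer d).1).toReal

lemma smoothBesov_core {d : ℕ} (P : DyadicPartition d) (α : ℝ) (p : ℝ≥0∞) [hp : Fact (1 ≤ p)] :
    SeminormedSpace.Core ℂ (SmoothBesov P α p) where
  norm_nonneg _ := ENNReal.toReal_nonneg
  norm_smul c f := by
    change (besovENorm P α p (c • show SmoothPer d from f : SmoothPer d)).toReal = _
    rw [besovENorm_smul, ENNReal.toReal_mul, toReal_enorm]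
    rfl
  norm_triangle f g := by
    change (besovENorm P α p ((show SmoothPer d from f) + (show SmoothPer d from g) : SmoothPer d)).toReal ≤ _
    have hf := (besovENorm_lt_top P α p f).ne
    have hg := (besovENorm_lt_top P α p g).ne
    refine (ENNReal.toReal_mono (ENNReal.add_ne_top.mpr ⟨hf, hg⟩)
      (besovENorm_add_le P α p hp.out f g)).trans ?_
    rw [ENNReal.toReal_add hf hg]
    rfl

instance {d : ℕ} (P : DyadicPartition d) (α : ℝ) (p : ℝ≥0∞) [Fact (1 ≤ p)] :
    SeminormedAddCommGroup (SmoothBesov P α p) :=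
  SeminormedAddCommGroup.ofCore (smoothBesov_core P α p)

instance {d : ℕ} (P : DyadicPartition d) (α : ℝ) (p : ℝ≥0∞) [Fact (1 ≤ p)] :
    NormedSpace ℂ (SmoothBesov P α p) where
  norm_smul_le c f := ((smoothBesov_core P α p).norm_smul c f).le

/-- The Besov space `B^α_{p,∞}`: the completion of the space of smooth periodic functions with
respect to the norm `sup_{k ≥ -1} 2^{αk} ‖δ_k f‖_{L^p}`. -/
abbrev BesovSpace {d : ℕ} (P : DyadicPartition d) (α : ℝ) (p : ℝ≥0∞) [Fact (1 ≤ p)] : Type :=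
  UniformSpace.Completion (SmoothBesov P α p)

/-- A smooth periodic function as an element of `B^α_{p,∞}`. -/
def toBesov {d : ℕ} (P : DyadicPartition d) (α : ℝ) (p : ℝ≥0∞) [Fact (1 ≤ p)] (f : SmoothPer d) :
    BesovSpace P α p :=
  UniformSpace.Completion.coe' (show SmoothBesov P α p from f)

lemma norm_toBesov {d : ℕ} (P : DyadicPartition d) (α : ℝ) (p : ℝ≥0∞) [Fact (1 ≤ p)]
    (f : SmoothPer d) : ‖toBesov P α p f‖ = (besovENorm P α p f).toReal :=
  UniformSpace.Completion.norm_coe _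

end TorusBesov

end

open TorusBesov

/-! The commutator is the sum over `k` of the shells `e^{tΔ}(S_{k-1}f δ_k g) - S_{k-1}f δ_k
e^{tΔ}g`, and `δ_k` commutes with the heat flow, so each shell is a commutator of a convolution with
the multiplication by `A = S_{k-1}f`, applied to `B = δ_k g`. Both `AB` and `B` have frequencies in
the annulus `2^k/12 ≤ |ζ| ≤ 2^k·10/3`. The Gaussian may therefore be replaced by a kernel `K` with
symbol `h(ζ/2^k)`, where `h` is a cut-off of `exp(-t4^k|ζ|²)` (`shellCommutator_eq`).

Since `K⋆(AB) - A(K⋆B) = ∫ K(y)(A(x-y) - A(x))B(x-y) dy`, Minkowski and Hölder bound a shell by the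
first moment of `K` times `‖∇A‖_{p₁}‖B‖_{p₂}` (`eLpNorm_conv_commutator_le`). Up to constants: the
moment is at most `2^{-k}(t4^k)^{-N}` for any fixed `N ≥ 0` (`exists_localized_heat`); `‖∇S_{k-1}f‖
≤ 2^{(1-α)k}‖f‖`, by Bernstein's inequality and a geometric sum that needs `α < 1`
(`exists_gradENorm_lowPer_le`); `‖δ_k g‖ ≤ 2^{-βk}‖g‖`. With `N = (γ-α-β)/2 ≥ 0` the product is
`t^{(α+β-γ)/2} 2^{-γk}‖f‖‖g‖` (`exists_shellCommutator_le`).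

A block `δ_j` meets only the seven shells `j-2 ≤ k ≤ j+4` (`block_commPer`), so the shell bounds add
up to the Besov bound on smooth functions (`exists_besovENorm_commPer_le`), and density gives the
extension (`exists_completion_extend₂`).

Frequency supports are handled without distributions or Fourier series: convolution with `K` has the
symbol `convSymbol K`, and every vanishing or reproducing statement comes from Fourier inversion for
Schwartz kernels and Fubini (`conv_mul_conv_eq_zero`, `conv_mulKernel`). -/

namespace TorusBesov

variable {d : ℕ}

/-! ### Convolution with an integrable kernel -/

/-- The convolution `K ⋆ f`. -/
noncomputable def conv (K f : Space d → ℂ) (x : Space d) : ℂ := ∫ y, K y * f (x - y)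

/-- The Gaussian kernel of the heat semigroup. -/
noncomputable def gauss (t : ℝ) (y : Space d) : ℂ :=
  (((4 * Real.pi * t) ^ (-(d : ℝ) / 2) * Real.exp (-‖y‖ ^ 2 / (4 * t)) : ℝ) : ℂ)

lemma block_eq_conv (P : DyadicPartition d) (k : ℤ) (f : Space d → ℂ) :
    block P k f = conv (kernel P k) f := rfl

/-- Smoothness by induction on the order, for a whole class at once: stability under directional
derivatives replaces any formula for higher derivatives. It serves for convolutions and for sums of
paraproducts. -/
lemma contDiff_of_fderiv_mem {E F : Type*} [NormedAddCommGroup E] [NormedSpace ℝ E]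
    [FiniteDimensional ℝ E] [NormedAddCommGroup F] [NormedSpace ℝ F] (S : Set (E → F))
    (h : ∀ f ∈ S, Differentiable ℝ f ∧ ∀ v, (fun x => fderiv ℝ f x v) ∈ S) {f : E → F}
    (hf : f ∈ S) : ContDiff ℝ ∞ f := by
  rw [contDiff_infty]
  intro n
  induction n generalizing f with
  | zero => exact contDiff_zero.2 (h f hf).1.continuous
  | succ n ih =>
    have := (contDiff_succ_iff_fderiv_apply (𝕜 := ℝ) (f := f) (n := n)).2
      ⟨(h f hf).1, by simp, fun v => ih ((h f hf).2 v)⟩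
    exact_mod_cast this

lemma norm_clm_le_sum {F : Type*} [NormedAddCommGroup F] [NormedSpace ℝ F]
    (L : Space d →L[ℝ] F) : ‖L‖ ≤ ∑ i, ‖L (EuclideanSpace.single i (1 : ℝ))‖ := by
  refine L.opNorm_le_bound (Finset.sum_nonneg fun _ _ => norm_nonneg _) fun x => ?_
  have hx : x = ∑ i, x i • EuclideanSpace.single i (1 : ℝ) := by
    simpa using ((EuclideanSpace.basisFun (Fin d) ℝ).sum_repr x).symm
  conv_lhs => rw [hx, map_sum]
  rw [Finset.sum_mul]
  refine (norm_sum_le _ _).trans (Finset.sum_le_sum fun i _ => ?_)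
  rw [map_smul, norm_smul, mul_comm]
  exact mul_le_mul_of_nonneg_left (PiLp.norm_apply_le x i) (norm_nonneg _)

lemma exists_bound_fderiv (f : SmoothPer d) :
    ∃ C, ∀ x, ‖fderiv ℝ (f : Space d → ℂ) x‖ ≤ C := by
  choose C hC using fun i => exists_bound (dirDeriv (EuclideanSpace.single i (1 : ℝ)) f)
  exact ⟨∑ i, C i, fun x => (norm_clm_le_sum _).trans (Finset.sum_le_sum fun i _ => hC i x)⟩

lemma continuous_coe (f : SmoothPer d) : Continuous (f : Space d → ℂ) := f.2.1.continuous

lemma hasFDerivAt_coe (f : SmoothPer d) (x : Space d) :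
    HasFDerivAt (f : Space d → ℂ) (fderiv ℝ (f : Space d → ℂ) x) x :=
  (f.2.1.differentiable (by simp) x).hasFDerivAt

lemma integrable_mul_comp_sub {K f : Space d → ℂ} (hK : Integrable K) (hf : Continuous f)
    {C : ℝ} (hC : ∀ x, ‖f x‖ ≤ C) (x : Space d) : Integrable fun y => K y * f (x - y) :=
  hK.mul_bdd (c := C) (hf.comp (by fun_prop)).aestronglyMeasurable
    (Filter.Eventually.of_forall fun _ => hC _)

lemma norm_conv_le {K f : Space d → ℂ} (hK : Integrable K) {C : ℝ} (hC : ∀ x, ‖f x‖ ≤ C)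
    (x : Space d) : ‖conv K f x‖ ≤ (∫ y, ‖K y‖) * C := by
  rw [← integral_mul_const]
  refine norm_integral_le_of_norm_le (hK.norm.mul_const C)
    (Filter.Eventually.of_forall fun w => ?_)
  rw [norm_mul]
  exact mul_le_mul_of_nonneg_left (hC _) (norm_nonneg _)

lemma hasFDerivAt_conv {K : Space d → ℂ} (hK : Integrable K) (f : SmoothPer d) (x : Space d) :
    HasFDerivAt (conv K f) (∫ y, K y • fderiv ℝ (f : Space d → ℂ) (x - y)) x := by
  obtain ⟨C, hC⟩ := exists_bound f
  obtain ⟨C', hC'⟩ := exists_bound_fderiv f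
  have hc := continuous_coe f
  have hc' : Continuous (fderiv ℝ (f : Space d → ℂ)) := f.2.1.continuous_fderiv (by simp)
  refine hasFDerivAt_integral_of_dominated_of_fderiv_le (s := Set.univ)
    (F := fun x y => K y * (f : Space d → ℂ) (x - y)) (bound := fun y => ‖K y‖ * C')
    (F' := fun x y => K y • fderiv ℝ (f : Space d → ℂ) (x - y)) Filter.univ_mem
    (Filter.Eventually.of_forall fun z =>
      (integrable_mul_comp_sub hK hc hC z).aestronglyMeasurable)
    (integrable_mul_comp_sub hK hc hC x) ?_ ?_ (hK.norm.mul_const C') ?_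
  · exact hK.aestronglyMeasurable.smul (hc'.comp (by fun_prop)).aestronglyMeasurable
  · refine Filter.Eventually.of_forall fun y z _ => ?_
    rw [norm_smul]
    exact mul_le_mul_of_nonneg_left (hC' _) (norm_nonneg _)
  · refine Filter.Eventually.of_forall fun y z _ => ?_
    have := (hasFDerivAt_coe f (z - y)).comp z ((hasFDerivAt_id z).sub_const y)
    simpa using! this.const_smul (K y)

lemma fderiv_conv_apply {K : Space d → ℂ} (hK : Integrable K) (f : SmoothPer d)
    (x v : Space d) : fderiv ℝ (conv K f) x v = conv K (dirDeriv v f) x := by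
  obtain ⟨C', hC'⟩ := exists_bound_fderiv f
  have hc' : Continuous (fderiv ℝ (f : Space d → ℂ)) := f.2.1.continuous_fderiv (by simp)
  have hi : Integrable fun y => K y • fderiv ℝ (f : Space d → ℂ) (x - y) := by
    refine Integrable.mono' (hK.norm.mul_const C')
      (hK.aestronglyMeasurable.smul (hc'.comp (by fun_prop)).aestronglyMeasurable)
      (Filter.Eventually.of_forall fun y => ?_)
    rw [norm_smul]
    exact mul_le_mul_of_nonneg_left (hC' _) (norm_nonneg _)
  rw [(hasFDerivAt_conv hK f x).fderiv, ContinuousLinearMap.integral_apply hi]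
  simp [conv, dirDeriv]

lemma conv_mem {K : Space d → ℂ} (hK : Integrable K) (f : SmoothPer d) :
    conv K f ∈ SmoothPer d := by
  refine ⟨?_, fun n x => ?_⟩
  · refine contDiff_of_fderiv_mem {F | ∃ g : SmoothPer d, F = conv K g} ?_ ⟨f, rfl⟩
    rintro _ ⟨g, rfl⟩
    exact ⟨fun x => (hasFDerivAt_conv hK g x).differentiableAt,
      fun v => ⟨dirDeriv v g, funext fun x => fderiv_conv_apply hK g x v⟩⟩
  · simp only [conv, add_sub_right_comm, f.2.2]

/-- Convolution with an integrable kernel, on smooth periodic functions. -/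
noncomputable def convPer {K : Space d → ℂ} (hK : Integrable K) (f : SmoothPer d) :
    SmoothPer d := ⟨conv K f, conv_mem hK f⟩

lemma dirDeriv_convPer {K : Space d → ℂ} (hK : Integrable K) (v : Space d) (f : SmoothPer d) :
    dirDeriv v (convPer hK f) = convPer hK (dirDeriv v f) :=
  Subtype.ext (funext fun x => fderiv_conv_apply hK f x v)

/-- Products of smooth periodic functions. -/
def mulPer (f g : SmoothPer d) : SmoothPer d :=
  ⟨fun x => (f : Space d → ℂ) x * (g : Space d → ℂ) x, f.2.1.mul g.2.1,
    fun n x => by simp only [f.2.2, g.2.2]⟩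

lemma conv_comm {K L f : Space d → ℂ} (hK : Integrable K) (hL : Integrable L)
    (hf : Continuous f) {C : ℝ} (hC : ∀ x, ‖f x‖ ≤ C) :
    conv K (conv L f) = conv L (conv K f) := by
  ext x
  have hi : Integrable (fun z : Space d × Space d => K z.1 * L z.2 * f (x - z.1 - z.2))
      (volume.prod volume) :=
    (hK.mul_prod hL).mul_bdd (c := C) (hf.comp (by fun_prop)).aestronglyMeasurable
      (Filter.Eventually.of_forall fun _ => hC _)
  simp only [conv, ← integral_const_mul]
  have := integral_integral_swap (f := fun y z => K y * L z * f (x - y - z)) hi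
  calc _ = ∫ y, ∫ z, K y * L z * f (x - y - z) := by simp only [mul_assoc]
    _ = _ := by
      rw [this]
      congr 1; ext z; congr 1; ext y
      rw [sub_right_comm]; ring

lemma conv_tsum {ι : Type*} [Countable ι] {K : Space d → ℂ} (hK : Integrable K)
    {F : ι → Space d → ℂ} (hF : ∀ i, Continuous (F i)) {u : ι → ℝ} (hu : Summable u)
    (hFu : ∀ i x, ‖F i x‖ ≤ u i) (x : Space d) :
    HasSum (fun i => conv K (F i) x) (conv K (fun x => ∑' i, F i x) x) := by
  have hi : ∀ i, Integrable fun y => K y * F i (x - y) := fun i =>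
    integrable_mul_comp_sub hK (hF i) (hFu i) x
  have h0 : ∀ i, 0 ≤ u i := fun i => (norm_nonneg _).trans (hFu i 0)
  have := hasSum_integral_of_summable_integral_norm hi ?_
  · simp only [tsum_mul_left] at this
    exact this
  · refine Summable.of_nonneg_of_le (fun i => integral_nonneg fun _ => norm_nonneg _) (fun i => ?_)
      (hu.mul_left (∫ y, ‖K y‖))
    rw [← integral_mul_const]
    refine integral_mono (hi i).norm (hK.norm.mul_const _) fun y => ?_
    simp only [norm_mul]
    exact mul_le_mul_of_nonneg_left (hFu i _) (norm_nonneg _)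

/-! ### Kernels of Fourier multipliers -/

/-- The kernel of the Fourier multiplier with symbol `ζ ↦ h (ζ / l)`. -/
noncomputable def mulKernel (h : 𝓢(Space d, ℂ)) (l : ℝ) (y : Space d) : ℂ :=
  (((l / (2 * Real.pi)) ^ d : ℝ) : ℂ) * (𝓕⁻ h) ((l / (2 * Real.pi)) • y)

/-- The symbol of the convolution with `K`. -/
noncomputable def convSymbol (K : Space d → ℂ) (ζ : Space d) : ℂ :=
  ∫ y, K y * Complex.exp (-(Complex.I * (inner ℝ y ζ : ℝ)))

/-- Reconciles two conventions: `𝓕⁻` integrates against `e^{2πi x·ζ}`, whereas `kernel` uses `e^{i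
x·ζ}` with the factor `(2π)^{-d}`. -/
lemma mulKernel_eq (h : 𝓢(Space d, ℂ)) {l : ℝ} (hl : 0 < l) (y : Space d) :
    mulKernel h l y = (((2 * Real.pi) ^ d : ℝ) : ℂ)⁻¹ *
      ∫ ζ : Space d, Complex.exp (Complex.I * (inner ℝ y ζ : ℝ)) * h (l⁻¹ • ζ) := by
  rw [mulKernel, SchwartzMap.fourierInv_coe, Real.fourierInv_eq']
  have e := Measure.integral_comp_inv_smul_of_nonneg (μ := (volume : Measure (Space d)))
    (fun ζ => Complex.exp (Complex.I * (inner ℝ y (l • ζ) : ℝ)) * h ζ) hl.le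
  simp only [smul_inv_smul₀ hl.ne'] at e
  rw [e, finrank_euclideanSpace_fin, div_pow, Complex.real_smul]
  push_cast
  rw [← mul_assoc]
  congr 1
  · field_simp
  · congr 1
    ext ζ
    rw [smul_eq_mul]
    congr 2
    simp only [inner_smul_right, real_inner_comm]
    push_cast
    have : (Real.pi : ℂ) ≠ 0 := by simp [Real.pi_ne_zero]
    field_simp

lemma continuous_mulKernel (h : 𝓢(Space d, ℂ)) (l : ℝ) : Continuous (mulKernel h l) :=
  continuous_const.mul ((𝓕⁻ h).continuous.comp (by fun_prop))

lemma integrable_mulKernel (h : 𝓢(Space d, ℂ)) {l : ℝ} (hl : 0 < l) :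
    Integrable (mulKernel h l) := by
  have hr : l / (2 * Real.pi) ≠ 0 := by positivity
  exact ((integrable_comp_smul_iff volume _ hr).2 (𝓕⁻ h).integrable).const_mul _

/-- The change of variables `y = (2π/l) w`; homogeneity of `F` in its last argument absorbs the
Jacobian. One statement yields the `L¹` norm, the first moment, the symbol and the action on
functions. -/
lemma integral_mulKernel_mul {E : Type*} [NormedAddCommGroup E] [NormedSpace ℝ E]
    (F : Space d → ℂ → E) (hF : ∀ x (c : ℝ) z, 0 ≤ c → F x (c * z) = c • F x z)
    (h : 𝓢(Space d, ℂ)) {l : ℝ} (hl : 0 < l) :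
    ∫ y, F y (mulKernel h l y) = ∫ w, F ((2 * Real.pi / l) • w) ((𝓕⁻ h) w) := by
  have hr : (0 : ℝ) < l / (2 * Real.pi) := by positivity
  have e := Measure.integral_comp_smul_of_nonneg (μ := (volume : Measure (Space d)))
    (fun w => F ((2 * Real.pi / l) • w) ((𝓕⁻ h) w)) (l / (2 * Real.pi)) (hR := hr.le)
  have hinv : (2 * Real.pi / l) = (l / (2 * Real.pi))⁻¹ := by rw [inv_div]
  rw [finrank_euclideanSpace_fin] at e
  rw [hinv] at e ⊢
  simp only [inv_smul_smul₀ hr.ne'] at e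
  simp only [mulKernel, hF _ _ _ (pow_nonneg hr.le d), integral_smul]
  rw [e, smul_smul, mul_inv_cancel₀ (pow_ne_zero _ hr.ne'), one_smul]

lemma integral_norm_mulKernel (h : 𝓢(Space d, ℂ)) {l : ℝ} (hl : 0 < l) :
    ∫ y, ‖mulKernel h l y‖ = ∫ w, ‖(𝓕⁻ h) w‖ :=
  integral_mulKernel_mul (fun _ z => ‖z‖) (fun _ c z hc => by simp [abs_of_nonneg hc]) h hl

lemma integral_norm_mul_norm_mulKernel (h : 𝓢(Space d, ℂ)) {l : ℝ} (hl : 0 < l) :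
    ∫ y, ‖y‖ * ‖mulKernel h l y‖ = 2 * Real.pi / l * ∫ w, ‖w‖ * ‖(𝓕⁻ h) w‖ := by
  have h0 : 0 ≤ 2 * Real.pi / l := by positivity
  rw [integral_mulKernel_mul (fun y z => ‖y‖ * ‖z‖)
    (fun _ c z hc => by simp [abs_of_nonneg hc]; ring) h hl, ← integral_const_mul]
  simp only [norm_smul, Real.norm_of_nonneg h0, mul_assoc]

lemma integrable_norm_mul_norm_mulKernel (h : 𝓢(Space d, ℂ)) {l : ℝ} (hl : 0 < l) :
    Integrable fun y => ‖y‖ * ‖mulKernel h l y‖ := by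
  have hr : 0 < l / (2 * Real.pi) := by positivity
  have h1 : Integrable fun w => ‖w‖ * ‖(𝓕⁻ h) w‖ := by
    have := (𝓕⁻ h).integrable_pow_mul volume 1
    simp only [pow_one] at this
    exact this
  have h2 := ((integrable_comp_smul_iff volume _ hr.ne').2 h1).const_mul
    ((l / (2 * Real.pi)) ^ d * (l / (2 * Real.pi))⁻¹)
  refine h2.congr (Filter.Eventually.of_forall fun y => ?_)
  simp only [mulKernel, norm_mul, norm_smul, Complex.norm_real, Real.norm_eq_abs, abs_pow,
    abs_of_pos hr]
  field_simp

/-- Fourier inversion `𝓕 (𝓕⁻ h) = h`, after rescaling. -/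
lemma convSymbol_mulKernel (h : 𝓢(Space d, ℂ)) {l : ℝ} (hl : 0 < l) (ζ : Space d) :
    convSymbol (mulKernel h l) ζ = h (l⁻¹ • ζ) := by
  rw [convSymbol, integral_mulKernel_mul
    (fun y z => z * Complex.exp (-(Complex.I * (inner ℝ y ζ : ℝ))))
    (fun _ c z hc => by rw [Complex.real_smul, mul_assoc]) h hl]
  have := congrArg (fun g : 𝓢(Space d, ℂ) => g (l⁻¹ • ζ))
    (show 𝓕 (𝓕⁻ h) = h from FourierTransform.fourier_fourierInv_eq h)
  rw [← this, SchwartzMap.fourier_coe, Real.fourier_eq']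
  congr 1
  ext w
  rw [smul_eq_mul, mul_comm]
  congr 2
  simp only [inner_smul_right, inner_smul_left, conj_trivial]
  push_cast
  field_simp

/-! ### Littlewood-Paley kernels and their symbols. -/

lemma kernel_neg_one (P : DyadicPartition d) : kernel P (-1) = mulKernel (lowSchwartz P) 1 := by
  ext y
  rw [mulKernel_eq _ one_pos, kernel]
  simp [symbol]
  rfl

lemma kernel_of_ne (P : DyadicPartition d) {k : ℤ} (hk : k ≠ -1) :
    kernel P k = mulKernel (bumpSchwartz P) ((2 : ℝ) ^ k) := by
  ext y
  rw [mulKernel_eq _ (by positivity), kernel]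
  simp [symbol, hk]
  rfl

/-- Allows the low-frequency block and the dyadic blocks to be treated by a single argument. -/
lemma exists_kernel_eq (P : DyadicPartition d) (k : ℤ) : ∃ (h : 𝓢(Space d, ℂ)) (l : ℝ),
    0 < l ∧ kernel P k = mulKernel h l ∧ ∀ ζ, h (l⁻¹ • ζ) = symbol P k ζ := by
  by_cases hk : k = -1
  · subst hk
    exact ⟨_, 1, one_pos, kernel_neg_one P, fun ζ => by simp [symbol]; rfl⟩
  · exact ⟨_, _, by positivity, kernel_of_ne P hk, fun ζ => by simp [symbol, hk]; rfl⟩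

lemma integrable_kernel (P : DyadicPartition d) (k : ℤ) : Integrable (kernel P k) := by
  obtain ⟨h, l, hl, e, -⟩ := exists_kernel_eq P k
  rw [e]
  exact integrable_mulKernel h hl

lemma convSymbol_kernel (P : DyadicPartition d) (k : ℤ) (ζ : Space d) :
    convSymbol (kernel P k) ζ = symbol P k ζ := by
  obtain ⟨h, l, hl, e, e'⟩ := exists_kernel_eq P k
  rw [e, convSymbol_mulKernel h hl, e']

/-! ### The heat kernel and its symbol. -/

lemma gauss_eq {t : ℝ} (y : Space d) : gauss t y =
    (((4 * Real.pi * t) ^ (-(d : ℝ) / 2) : ℝ) : ℂ) *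
      Complex.exp (-((1 / (4 * t) : ℝ) : ℂ) * (‖y‖ : ℂ) ^ 2) := by
  rw [gauss]
  push_cast
  congr 2
  ring

lemma integrable_gauss {t : ℝ} (ht : 0 < t) : Integrable (gauss t : Space d → ℂ) := by
  have hb : 0 < ((1 / (4 * t) : ℝ) : ℂ).re := by rw [Complex.ofReal_re]; positivity
  have := GaussianFourier.integrable_cexp_neg_mul_sq_norm_add hb 0 (0 : Space d)
  simp only [zero_mul, add_zero] at this
  exact (this.const_mul _).congr (Filter.Eventually.of_forall fun y => (gauss_eq y).symm)

lemma convSymbol_gauss {t : ℝ} (ht : 0 < t) (ζ : Space d) :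
    convSymbol (gauss t) ζ = Real.exp (-t * ‖ζ‖ ^ 2) := by
  have hb : 0 < ((1 / (4 * t) : ℝ) : ℂ).re := by rw [Complex.ofReal_re]; positivity
  have h := GaussianFourier.integral_cexp_neg_mul_sq_norm_add hb (-Complex.I) ζ
  have e : ∀ y : Space d, gauss t y * Complex.exp (-(Complex.I * (inner ℝ y ζ : ℝ))) =
      (((4 * Real.pi * t) ^ (-(d : ℝ) / 2) : ℝ) : ℂ) *
        Complex.exp (-((1 / (4 * t) : ℝ) : ℂ) * (‖y‖ : ℂ) ^ 2 +
          -Complex.I * (inner ℝ ζ y : ℝ)) := by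
    intro y
    rw [gauss_eq, mul_assoc, ← Complex.exp_add, real_inner_comm, neg_mul Complex.I]
  simp only [convSymbol, e, integral_const_mul, h]
  rw [finrank_euclideanSpace_fin, ← mul_assoc]
  -- The Gaussian integral with parameter `b = 1/(4t)` produces `(π/b)^{d/2} = (4πt)^{d/2}`, which
  -- cancels the normalization.
  have h1 : (Real.pi : ℂ) / ((1 / (4 * t) : ℝ) : ℂ) = ((4 * Real.pi * t : ℝ) : ℂ) := by
    push_cast
    have : (t : ℂ) ≠ 0 := by exact_mod_cast ht.ne'
    field_simp
  have h2 : ((d : ℂ) / 2) = (((d : ℝ) / 2 : ℝ) : ℂ) := by push_cast; rfl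
  have h3 : (0 : ℝ) < 4 * Real.pi * t := by positivity
  rw [h1, h2, ← Complex.ofReal_cpow h3.le, ← Complex.ofReal_mul, ← Real.rpow_add h3]
  have h4 : -(d : ℝ) / 2 + d / 2 = 0 := by ring
  rw [h4, Real.rpow_zero, Complex.ofReal_one, one_mul, Complex.ofReal_exp]
  congr 1
  push_cast
  have : (t : ℂ) ≠ 0 := by exact_mod_cast ht.ne'
  rw [neg_sq, Complex.I_sq]
  field_simp

/-! ### Smoothness of blocks and of the paraproduct -/

lemma heat_mem {t : ℝ} (ht : 0 < t) (g : SmoothPer d) : heat t g ∈ SmoothPer d :=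
  conv_mem (integrable_gauss ht) g

/-- Littlewood-Paley blocks of smooth periodic functions. -/
noncomputable def blockPer (P : DyadicPartition d) (k : ℤ) (f : SmoothPer d) : SmoothPer d :=
  convPer (integrable_kernel P k) f

/-- The heat semigroup on smooth periodic functions. -/
noncomputable def heatPer {t : ℝ} (ht : 0 < t) (f : SmoothPer d) : SmoothPer d :=
  convPer (integrable_gauss ht) f

/-- Partial Littlewood-Paley sums of smooth periodic functions. -/
noncomputable def lowPer (P : DyadicPartition d) (k : ℤ) (f : SmoothPer d) : SmoothPer d :=
  ∑ j ∈ Finset.Ico (-1) k, blockPer P j f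

@[simp] lemma coe_blockPer (P : DyadicPartition d) (k : ℤ) (f : SmoothPer d) :
    (blockPer P k f : Space d → ℂ) = block P k f := rfl

@[simp] lemma coe_heatPer {t : ℝ} (ht : 0 < t) (f : SmoothPer d) :
    (heatPer ht f : Space d → ℂ) = heat t f := rfl

@[simp] lemma coe_lowPer (P : DyadicPartition d) (k : ℤ) (f : SmoothPer d) :
    (lowPer P k f : Space d → ℂ) = lowPart P k f := by
  ext x
  simp [lowPer, lowPart]

lemma dirDeriv_add (v : Space d) (f g : SmoothPer d) :
    dirDeriv v (f + g) = dirDeriv v f + dirDeriv v g := by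
  ext x
  have := ((hasFDerivAt_coe f x).add (hasFDerivAt_coe g x)).fderiv
  change fderiv ℝ ((f : Space d → ℂ) + (g : Space d → ℂ)) x v = _
  rw [this]
  rfl

lemma dirDeriv_zero (v : Space d) : dirDeriv v (0 : SmoothPer d) = 0 := by
  simpa using dirDeriv_add v (0 : SmoothPer d) 0

lemma dirDeriv_sum {ι : Type*} (s : Finset ι) (v : Space d) (f : ι → SmoothPer d) :
    dirDeriv v (∑ i ∈ s, f i) = ∑ i ∈ s, dirDeriv v (f i) :=
  map_sum (⟨⟨dirDeriv v, dirDeriv_zero v⟩, dirDeriv_add v⟩ : SmoothPer d →+ SmoothPer d) f s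

lemma dirDeriv_blockPer (P : DyadicPartition d) (k : ℤ) (v : Space d) (f : SmoothPer d) :
    dirDeriv v (blockPer P k f) = blockPer P k (dirDeriv v f) :=
  dirDeriv_convPer _ v f

lemma dirDeriv_lowPer (P : DyadicPartition d) (k : ℤ) (v : Space d) (f : SmoothPer d) :
    dirDeriv v (lowPer P k f) = lowPer P k (dirDeriv v f) := by
  simp only [lowPer, dirDeriv_sum, dirDeriv_blockPer]

lemma summable_half_pow_natAbs : Summable fun k : ℤ => (1 / 2 : ℝ) ^ k.natAbs := by
  have h : Summable fun n : ℕ => (1 / 2 : ℝ) ^ n := summable_geometric_two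
  refine Summable.of_nat_of_neg ?_ ?_ <;> simpa using h

/-- Smooth functions have rapidly decaying blocks; one power of `2^{-k}` is enough for the absolute
convergence of all series below. -/
lemma exists_bound_blocks (P : DyadicPartition d) (f : SmoothPer d) :
    ∃ C, ∀ k : ℤ, -1 ≤ k → ∀ x, ‖block P k f x‖ ≤ C * (1 / 2) ^ k.natAbs := by
  obtain ⟨C, hC⟩ := exists_block_bound P 1 f
  have hC0 : 0 ≤ C := le_trans (by positivity) (hC 0 (by norm_num) 0)
  -- The factor `4` is forced by `k = -1`: there the bound reads `‖δ_{-1} f‖ ≤ 2C`, while `natAbs`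
  -- gives the weight `1/2`.
  refine ⟨4 * C, fun k hk x => ?_⟩
  have h := hC k hk x
  rw [one_mul, Real.rpow_intCast] at h
  rcases eq_or_lt_of_le hk with rfl | hk
  · norm_num at h ⊢
    linarith
  · obtain ⟨n, rfl⟩ := Int.eq_ofNat_of_zero_le (show 0 ≤ k by omega)
    rw [zpow_natCast] at h
    simp only [Int.natAbs_natCast, one_div, inv_pow]
    have : (0 : ℝ) < 2 ^ n := by positivity
    rw [← div_eq_mul_inv, le_div_iff₀ this]
    linarith

lemma exists_bound_lowPart (P : DyadicPartition d) (f : SmoothPer d) :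
    ∃ C, ∀ (k : ℤ) x, ‖lowPart P k f x‖ ≤ C := by
  obtain ⟨C, hC⟩ := exists_bound_blocks P f
  have hC0 : 0 ≤ C := by simpa using (norm_nonneg _).trans (hC 0 (by norm_num) 0)
  refine ⟨C * ∑' k : ℤ, (1 / 2 : ℝ) ^ k.natAbs, fun k x => ?_⟩
  refine (norm_sum_le _ _).trans ((Finset.sum_le_sum fun j hj =>
    hC j (Finset.mem_Ico.1 hj).1 x).trans ?_)
  rw [← Finset.mul_sum]
  exact mul_le_mul_of_nonneg_left
    (summable_half_pow_natAbs.sum_le_tsum _ fun _ _ => by positivity) hC0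

lemma lowPart_of_nonpos (P : DyadicPartition d) {k : ℤ} (hk : k ≤ 0) (f : Space d → ℂ) :
    lowPart P (k - 1) f = 0 := by
  ext x
  rw [lowPart, Finset.Ico_eq_empty (by omega)]
  rfl

lemma exists_bound_paraproduct (P : DyadicPartition d) (f g : SmoothPer d) :
    ∃ C, ∀ (k : ℤ) x, ‖lowPart P (k - 1) f x‖ * ‖block P k g x‖ ≤ C * (1 / 2) ^ k.natAbs := by
  obtain ⟨C, hC⟩ := exists_bound_lowPart P f
  obtain ⟨C', hC'⟩ := exists_bound_blocks P g
  have hC0 : 0 ≤ C := (norm_nonneg _).trans (hC 0 0)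
  have hC0' : 0 ≤ C' := by simpa using (norm_nonneg _).trans (hC' 0 (by norm_num) 0)
  refine ⟨C * C', fun k x => ?_⟩
  by_cases hk : k ≤ 0
  · rw [lowPart_of_nonpos P hk]
    simp only [Pi.zero_apply, norm_zero, zero_mul]
    positivity
  · rw [mul_assoc]
    exact mul_le_mul (hC _ x) (hC' k (by omega) x) (norm_nonneg _) hC0

lemma summable_paraproduct (P : DyadicPartition d) (f g : SmoothPer d) (x : Space d) :
    Summable fun k : ℤ => lowPart P (k - 1) f x * block P k g x := by
  obtain ⟨C, hC⟩ := exists_bound_paraproduct P f g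
  exact Summable.of_norm_bounded (summable_half_pow_natAbs.mul_left C) fun k => by
    simpa using hC k x

/-- Termwise differentiation with the Leibniz rule. Derivatives commute with blocks and partial
sums, so the differentiated series consists of paraproducts of smooth functions and has the same
geometric majorant. -/
lemma hasFDerivAt_paraproduct (P : DyadicPartition d) (f g : SmoothPer d) (x : Space d) :
    DifferentiableAt ℝ (paraproduct P f g) x ∧ ∀ v, fderiv ℝ (paraproduct P f g) x v =
      paraproduct P (dirDeriv v f) g x + paraproduct P f (dirDeriv v g) x := by
  choose C hC using fun i =>
    exists_bound_paraproduct P (dirDeriv (EuclideanSpace.single i (1 : ℝ)) f) g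
  choose C' hC' using fun i =>
    exists_bound_paraproduct P f (dirDeriv (EuclideanSpace.single i (1 : ℝ)) g)
  let F' : ℤ → Space d → Space d →L[ℝ] ℂ := fun k x =>
    lowPart P (k - 1) f x • fderiv ℝ (block P k g) x +
      block P k g x • fderiv ℝ (lowPart P (k - 1) f) x
  have hlow : ∀ k v x, fderiv ℝ (lowPart P (k - 1) f) x v = lowPart P (k - 1) (dirDeriv v f) x := by
    intro k v x
    have := congrArg (fun h : SmoothPer d => (h : Space d → ℂ) x) (dirDeriv_lowPer P (k - 1) v f)
    simpa [dirDeriv] using this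
  have hblock : ∀ k v x, fderiv ℝ (block P k g) x v = block P k (dirDeriv v g) x := by
    intro k v x
    have := congrArg (fun h : SmoothPer d => (h : Space d → ℂ) x) (dirDeriv_blockPer P k v g)
    simpa [dirDeriv] using this
  have hd : ∀ k x, HasFDerivAt (fun x => lowPart P (k - 1) f x * block P k g x) (F' k x) x := by
    intro k x
    have h1 := hasFDerivAt_coe (lowPer P (k - 1) f) x
    have h2 := hasFDerivAt_coe (blockPer P k g) x
    simp only [coe_lowPer, coe_blockPer] at h1 h2
    exact h1.mul h2
  have hb : ∀ k x, ‖F' k x‖ ≤ (∑ i, (C i + C' i)) * (1 / 2) ^ k.natAbs := by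
    intro k x
    refine (norm_clm_le_sum _).trans ?_
    rw [Finset.sum_mul]
    refine Finset.sum_le_sum fun i _ => ?_
    simp only [F', add_apply, smul_apply, hlow, hblock, smul_eq_mul]
    refine (norm_add_le _ _).trans ?_
    rw [norm_mul, norm_mul, add_comm, add_mul]
    refine add_le_add ?_ (hC' i k x)
    rw [mul_comm]
    exact hC i k x
  have key := hasFDerivAt_tsum (summable_half_pow_natAbs.mul_left (∑ i, (C i + C' i))) hd hb
    (summable_paraproduct P f g 0) x
  refine ⟨key.differentiableAt, fun v => ?_⟩
  have hs : Summable fun k => F' k x :=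
    Summable.of_norm_bounded (summable_half_pow_natAbs.mul_left _) fun k => hb k x
  change fderiv ℝ (fun x => ∑' k : ℤ, lowPart P (k - 1) f x * block P k g x) x v = _
  rw [key.fderiv, ← ContinuousLinearMap.apply_apply v (∑' k, F' k x),
    ContinuousLinearMap.map_tsum _ hs]
  simp only [paraproduct]
  rw [← (summable_paraproduct P _ _ x).tsum_add (summable_paraproduct P _ _ x)]
  refine tsum_congr fun k => ?_
  simp only [F', ContinuousLinearMap.apply_apply, add_apply, smul_apply, hlow, hblock, smul_eq_mul]
  ring

lemma paraproduct_mem (P : DyadicPartition d) (f g : SmoothPer d) :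
    paraproduct P f g ∈ SmoothPer d := by
  refine ⟨?_, fun n x => ?_⟩
  -- Leibniz produces sums of paraproducts, so the class stable under differentiation is the
  -- additive closure.
  · let S := AddSubmonoid.closure {F | ∃ f g : SmoothPer d, F = paraproduct P f g}
    refine contDiff_of_fderiv_mem (S : Set (Space d → ℂ)) ?_
      (AddSubmonoid.subset_closure ⟨f, g, rfl⟩)
    intro F hF
    induction hF using AddSubmonoid.closure_induction with
    | mem F hF =>
      obtain ⟨f, g, rfl⟩ := hF
      refine ⟨fun x => (hasFDerivAt_paraproduct P f g x).1, fun v => ?_⟩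
      rw [show (fun x => fderiv ℝ (paraproduct P f g) x v) =
        paraproduct P (dirDeriv v f) g + paraproduct P f (dirDeriv v g) from
          funext fun x => (hasFDerivAt_paraproduct P f g x).2 v]
      exact S.add_mem (AddSubmonoid.subset_closure ⟨_, _, rfl⟩)
        (AddSubmonoid.subset_closure ⟨_, _, rfl⟩)
    | zero =>
      refine ⟨differentiable_const 0, fun v => ?_⟩
      have : (fun x => fderiv ℝ (0 : Space d → ℂ) x v) = 0 := by
        ext x
        simp
      rw [this]
      exact S.zero_mem
    | add F G _ _ hF hG =>
      refine ⟨hF.1.add hG.1, fun v => ?_⟩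
      have : (fun x => fderiv ℝ (F + G) x v) =
          (fun x => fderiv ℝ F x v) + fun x => fderiv ℝ G x v := by
        ext x
        rw [fderiv_add (hF.1 x) (hG.1 x)]
        rfl
      rw [this]
      exact S.add_mem (hF.2 v) (hG.2 v)
  · have h1 : ∀ k, lowPart P k f (x + latticeVec n) = lowPart P k f x := fun k => by
      rw [← coe_lowPer]; exact (lowPer P k f).2.2 n x
    have h2 : ∀ k, block P k g (x + latticeVec n) = block P k g x := fun k =>
      (blockPer P k g).2.2 n x
    simp only [paraproduct, h1, h2]

/-! ### Minkowski's integral inequality with a uniform bound -/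

/-- With a bound on the slices uniform in `z`, Minkowski reduces to Hölder in `z` against the
constant `1`, which gives the power `p - 1` of the total mass, followed by Tonelli. For `p = ∞` the
two almost-everywhere quantifiers are exchanged. -/
lemma eLpNorm_le_of_enorm_le_lintegral {X Z E F : Type*} [MeasurableSpace X] [MeasurableSpace Z]
    [NormedAddCommGroup E] [NormedAddCommGroup F] {μ : Measure X} {ν : Measure Z} [SFinite μ]
    [SFinite ν] {p : ℝ≥0∞} (hp : 1 ≤ p) {h : X → E} {G : X → Z → F} {M : ℝ≥0∞}
    (hG : Measurable fun z : X × Z => ‖G z.1 z.2‖ₑ) (hM : ∀ z, eLpNorm (fun x => G x z) p μ ≤ M)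
    (hh : ∀ x, ‖h x‖ₑ ≤ ∫⁻ z, ‖G x z‖ₑ ∂ν) : eLpNorm h p μ ≤ M * ν Set.univ := by
  by_cases hpt : p = ⊤
  · subst hpt
    simp only [eLpNorm_exponent_top] at hM ⊢
    have hae : ∀ᵐ x ∂μ, ∀ᵐ z ∂ν, ‖G x z‖ₑ ≤ M := by
      refine (Measure.ae_ae_comm (p := fun x z => ‖G x z‖ₑ ≤ M)
        (measurableSet_le hG measurable_const)).2 ?_
      refine Filter.Eventually.of_forall fun z => ?_
      filter_upwards [enorm_ae_le_eLpNormEssSup (fun x => G x z) μ] with x hx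
      exact hx.trans (hM z)
    refine eLpNormEssSup_le_of_ae_enorm_bound ?_
    filter_upwards [hae] with x hx
    refine (hh x).trans ((lintegral_mono_ae hx).trans ?_)
    rw [lintegral_const]
  · have hp0 : p ≠ 0 := (zero_lt_one.trans_le hp).ne'
    have hr : 1 ≤ p.toReal := by
      rw [← ENNReal.toReal_one]
      exact ENNReal.toReal_mono hpt hp
    have hr0 : 0 < p.toReal := by linarith
    rw [eLpNorm_eq_lintegral_rpow_enorm_toReal hp0 hpt]
    have hM' : ∀ z, ∫⁻ x, ‖G x z‖ₑ ^ p.toReal ∂μ ≤ M ^ p.toReal := by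
      intro z
      have := hM z
      rw [eLpNorm_eq_lintegral_rpow_enorm_toReal hp0 hpt, one_div,
        ENNReal.rpow_inv_le_iff hr0] at this
      exact this
    have hpt' : ∀ x, ‖h x‖ₑ ^ p.toReal ≤
        (∫⁻ z, ‖G x z‖ₑ ^ p.toReal ∂ν) * ν Set.univ ^ (p.toReal - 1) := by
      intro x
      have h1 := eLpNorm'_le_eLpNorm'_mul_rpow_measure_univ (μ := ν) (f := fun z => ‖G x z‖ₑ)
        one_pos hr (hG.comp measurable_prodMk_left).aestronglyMeasurable
      simp only [eLpNorm', enorm_eq_self, ENNReal.rpow_one, div_one] at h1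
      refine (ENNReal.rpow_le_rpow ((hh x).trans h1) hr0.le).trans ?_
      rw [ENNReal.mul_rpow_of_nonneg _ _ hr0.le, ← ENNReal.rpow_mul, ← ENNReal.rpow_mul,
        one_div_mul_cancel hr0.ne', ENNReal.rpow_one, sub_mul, one_div_mul_cancel hr0.ne', one_mul]
    rw [one_div, ENNReal.rpow_inv_le_iff hr0]
    calc ∫⁻ x, ‖h x‖ₑ ^ p.toReal ∂μ
        ≤ ∫⁻ x, (∫⁻ z, ‖G x z‖ₑ ^ p.toReal ∂ν) * ν Set.univ ^ (p.toReal - 1) ∂μ :=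
          lintegral_mono hpt'
      _ = (∫⁻ x, ∫⁻ z, ‖G x z‖ₑ ^ p.toReal ∂ν ∂μ) * ν Set.univ ^ (p.toReal - 1) :=
          lintegral_mul_const _ (hG.pow_const _).lintegral_prod_right
      _ = (∫⁻ z, ∫⁻ x, ‖G x z‖ₑ ^ p.toReal ∂μ ∂ν) * ν Set.univ ^ (p.toReal - 1) := by
          rw [lintegral_lintegral_swap (hG.pow_const _).aemeasurable]
      _ ≤ (∫⁻ _, M ^ p.toReal ∂ν) * ν Set.univ ^ (p.toReal - 1) := by
          gcongr with z
          exact hM' z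
      _ = (M * ν Set.univ) ^ p.toReal := by
          rw [lintegral_const, ENNReal.mul_rpow_of_nonneg _ _ hr0.le, mul_assoc]
          congr 1
          conv_lhs => rw [← ENNReal.rpow_one (ν Set.univ), ← ENNReal.rpow_mul, one_mul,
            ← ENNReal.rpow_add_of_nonneg _ _ zero_le_one (by linarith)]
          congr 1
          ring

/-! ### Translation invariance of the norms of periodic functions -/

/-- The basis `(2 e_i)` of the lattice `(2ℤ)^d`. -/
noncomputable def latticeBasis (d : ℕ) : Module.Basis (Fin d) ℝ (Space d) :=
  (EuclideanSpace.basisFun (Fin d) ℝ).toBasis.isUnitSMul (w := fun _ => 2)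
    fun _ => IsUnit.mk0 _ two_ne_zero

lemma latticeBasis_apply (i : Fin d) : latticeBasis d i = latticeVec (Pi.single i 1) := by
  ext j
  simp [latticeBasis, Module.Basis.isUnitSMul_apply, latticeVec, Pi.single_apply]

lemma latticeBasis_repr (x : Space d) (i : Fin d) : (latticeBasis d).repr x i = x i / 2 := by
  have h : (latticeBasis d).repr x i * 2 = x i := by
    conv_rhs => rw [← (latticeBasis d).sum_repr x]
    simp [latticeBasis, Module.Basis.isUnitSMul_apply, Pi.single_apply]
  linarith

lemma latticeVec_zero : latticeVec (0 : Fin d → ℤ) = 0 := by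
  ext j; simp [latticeVec]

lemma latticeVec_add (m n : Fin d → ℤ) : latticeVec (m + n) = latticeVec m + latticeVec n := by
  ext j; simp [latticeVec]; ring

lemma latticeVec_zsmul (a : ℤ) (n : Fin d → ℤ) : latticeVec (a • n) = a • latticeVec n := by
  ext j; simp [latticeVec]; ring

lemma exists_latticeVec {v : Space d}
    (hv : v ∈ Submodule.span ℤ (Set.range (latticeBasis d))) : ∃ n, v = latticeVec n := by
  induction hv using Submodule.span_induction with
  | mem x hx =>
    obtain ⟨i, rfl⟩ := hx
    exact ⟨_, latticeBasis_apply i⟩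
  | zero => exact ⟨0, latticeVec_zero.symm⟩
  | add x y _ _ hx hy =>
    obtain ⟨m, rfl⟩ := hx
    obtain ⟨n, rfl⟩ := hy
    exact ⟨m + n, (latticeVec_add m n).symm⟩
  | smul a x _ hx =>
    obtain ⟨n, rfl⟩ := hx
    exact ⟨a • n, (latticeVec_zsmul a n).symm⟩

/-- Translation by `(1,…,1)` carries the cell to `[0,2)^d`, the fundamental domain of the lattice
basis, up to the null set of boundary faces. -/
lemma cell_ae_eq :
    (cell d : Set (Space d)) =ᵐ[volume] (fun x : Space d => x + WithLp.toLp 2 fun _ => (1 : ℝ)) ⁻¹'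
      ZSpan.fundamentalDomain (latticeBasis d) := by
  have h := (EuclideanSpace.volume_preserving_symm_measurableEquiv_toLp
    (Fin d)).quasiMeasurePreserving.preimage_ae_eq
      (Measure.univ_pi_Ico_ae_eq_Icc (μ := fun _ : Fin d => (volume : Measure ℝ))
        (f := fun _ => -1) (g := fun _ => 1))
  have e1 : (cell d : Set (Space d)) = (MeasurableEquiv.toLp 2 (Fin d → ℝ)).symm ⁻¹'
      Set.Icc (fun _ => -1) fun _ => 1 := by
    ext x
    simp only [cell, Set.mem_ofPred_eq, Set.mem_preimage, Set.mem_Icc, Pi.le_def, forall_and]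
    rfl
  have e2 : (fun x : Space d => x + WithLp.toLp 2 fun _ => (1 : ℝ)) ⁻¹'
      ZSpan.fundamentalDomain (latticeBasis d) = (MeasurableEquiv.toLp 2 (Fin d → ℝ)).symm ⁻¹'
        Set.univ.pi fun _ => Set.Ico (-1) 1 := by
    ext x
    simp only [Set.mem_preimage, ZSpan.mem_fundamentalDomain, latticeBasis_repr, Set.mem_univ_pi,
      Set.mem_Ico, PiLp.add_apply]
    refine forall_congr' fun i => ?_
    change _ ↔ -1 ≤ x i ∧ x i < 1
    constructor <;> rintro ⟨h1, h2⟩ <;> constructor <;> linarith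
  rw [e1, e2]
  exact h.symm

open scoped Pointwise in
-- A translate of a fundamental domain is again one, and a periodic function has the same integral
-- over all of them.
lemma setLIntegral_fundamentalDomain_comp_add {F : Space d → ℝ≥0∞}
    (hper : ∀ n x, F (x + latticeVec n) = F x) (u : Space d) :
    ∫⁻ x in ZSpan.fundamentalDomain (latticeBasis d), F (x + u) =
      ∫⁻ x in ZSpan.fundamentalDomain (latticeBasis d), F x := by
  have hD := ZSpan.isAddFundamentalDomain' (latticeBasis d) volume
  have hD' := hD.vadd_of_comm (G' := Space d) u
  have e := (measurePreserving_add_right volume u).setLIntegral_comp_emb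
    (measurableEmbedding_addRight u) F (ZSpan.fundamentalDomain (latticeBasis d))
  rw [e]
  have himg : (fun x => x + u) '' ZSpan.fundamentalDomain (latticeBasis d) =
      u +ᵥ ZSpan.fundamentalDomain (latticeBasis d) := by
    ext x
    simp only [Set.mem_image, Set.mem_vadd_set, vadd_eq_add, add_comm]
  rw [himg]
  have : Countable (Submodule.span ℤ (Set.range (latticeBasis d))).toAddSubgroup :=
    inferInstanceAs (Countable (Submodule.span ℤ (Set.range (latticeBasis d))))
  refine hD'.setLIntegral_eq hD F fun g x => ?_
  obtain ⟨n, hn⟩ := exists_latticeVec g.2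
  rw [AddSubgroup.vadd_def, hn, vadd_eq_add, add_comm, hper]

lemma setLIntegral_cell_comp_sub {F : Space d → ℝ≥0∞}
    (hper : ∀ n x, F (x + latticeVec n) = F x) (y : Space d) :
    ∫⁻ x in cell d, F (x - y) = ∫⁻ x in cell d, F x := by
  have h : ∀ u, ∫⁻ x in cell d, F (x + u) =
      ∫⁻ x in ZSpan.fundamentalDomain (latticeBasis d), F x := by
    intro u
    let o : Space d := WithLp.toLp 2 fun _ => (1 : ℝ)
    have e := (measurePreserving_add_right volume o).setLIntegral_comp_preimage_emb
      (measurableEmbedding_addRight _) (fun x => F (x + (u - o)))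
      (ZSpan.fundamentalDomain (latticeBasis d))
    simp only [add_assoc, add_sub_cancel] at e
    rw [setLIntegral_congr cell_ae_eq, ← setLIntegral_fundamentalDomain_comp_add hper (u - o), ← e]
  simpa [sub_eq_add_neg] using (h (-y)).trans (h 0).symm

/-- For finite `p` this is the invariance of the integral of `‖F‖^p`. For `p = ∞` that invariance is
applied to the indicator of the set where the norm exceeds its essential supremum, which gives one
inequality; translating back gives the other. -/
lemma eLpNorm_cell_comp_sub {E : Type*} [NormedAddCommGroup E] {F : Space d → E}
    (hF : Continuous F) (hper : ∀ n x, F (x + latticeVec n) = F x) (p : ℝ≥0∞) (y : Space d) :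
    eLpNorm (fun x => F (x - y)) p (volume.restrict (cell d)) =
      eLpNorm F p (volume.restrict (cell d)) := by
  by_cases hp0 : p = 0
  · simp [hp0]
  by_cases hpt : p = ⊤
  · subst hpt
    have key : ∀ G : Space d → E, Continuous G → (∀ n x, G (x + latticeVec n) = G x) → ∀ y,
        eLpNorm (fun x => G (x - y)) ⊤ (volume.restrict (cell d)) ≤
          eLpNorm G ⊤ (volume.restrict (cell d)) := by
      intro G hG hGper y
      simp only [eLpNorm_exponent_top]
      refine eLpNormEssSup_le_of_ae_enorm_bound ?_
      set c := eLpNormEssSup G (volume.restrict (cell d))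
      have hm : MeasurableSet {x | ¬ ‖G x‖ₑ ≤ c} :=
        (measurableSet_le hG.enorm.measurable measurable_const).compl
      have h1 : ∫⁻ x in cell d, {x | ¬ ‖G x‖ₑ ≤ c}.indicator 1 x = 0 := by
        rw [lintegral_indicator_one hm]
        exact ae_iff.1 (enorm_ae_le_eLpNormEssSup G (volume.restrict (cell d)))
      rw [← setLIntegral_cell_comp_sub (fun n x => by simp [Set.indicator, hGper]) y] at h1
      have hm' : MeasurableSet {x | ¬ ‖G (x - y)‖ₑ ≤ c} := hm.preimage (measurable_sub_const y)
      have h2 : ∫⁻ x in cell d, {x | ¬ ‖G (x - y)‖ₑ ≤ c}.indicator 1 x = 0 := h1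
      rw [lintegral_indicator_one hm'] at h2
      exact ae_iff.2 h2
    refine le_antisymm (key F hF hper y) ?_
    have := key (fun x => F (x - y)) (by fun_prop)
      (fun n x => by rw [add_sub_right_comm, hper]) (-y)
    simpa using this
  · rw [eLpNorm_eq_lintegral_rpow_enorm_toReal hp0 hpt,
      eLpNorm_eq_lintegral_rpow_enorm_toReal hp0 hpt]
    congr 1
    exact setLIntegral_cell_comp_sub (F := fun x => ‖F x‖ₑ ^ p.toReal)
      (fun n x => by simp only [hper]) y

/-! ### Young's inequality and the first order commutator estimate -/

/-- Minkowski for the finite measure `|K(y)| dy`, each translate of `f` having the same norm over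
the cell. -/
lemma eLpNorm_conv_le {p : ℝ≥0∞} (hp : 1 ≤ p) {K : Space d → ℂ} (hK : Integrable K)
    (f : SmoothPer d) : eLpNorm (conv K f) p (volume.restrict (cell d)) ≤
      ENNReal.ofReal (∫ y, ‖K y‖) * eLpNorm (f : Space d → ℂ) p (volume.restrict (cell d)) := by
  have hf := continuous_coe f
  have h := eLpNorm_le_of_enorm_le_lintegral (μ := volume.restrict (cell d))
    (ν := volume.withDensity fun y => ‖K y‖ₑ) hp (h := conv K f)
    (G := fun x y => (f : Space d → ℂ) (x - y))
    (M := eLpNorm (f : Space d → ℂ) p (volume.restrict (cell d)))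
    (hf.comp (continuous_fst.sub continuous_snd)).enorm.measurable
    (fun y => (eLpNorm_cell_comp_sub hf f.2.2 p y).le) (fun x => by
      rw [lintegral_withDensity_eq_lintegral_mul₀ hK.aestronglyMeasurable.enorm (by fun_prop)]
      refine (enorm_integral_le_lintegral_enorm _).trans_eq ?_
      simp [enorm_mul])
  rw [withDensity_apply _ MeasurableSet.univ, Measure.restrict_univ,
    ← ofReal_integral_norm_eq_lintegral_enorm hK, mul_comm] at h
  exact h

/-- The sum of the norms of the partial derivatives. -/
noncomputable def gradENorm (p : ℝ≥0∞) (f : SmoothPer d) : ℝ≥0∞ :=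
  ∑ i, eLpNorm (dirDeriv (EuclideanSpace.single i (1 : ℝ)) f : Space d → ℂ) p
    (volume.restrict (cell d))

/-- The fundamental theorem of calculus along the segment from `x` to `x - y`, then Minkowski in the
segment parameter; translation invariance makes every slice equally large. -/
lemma eLpNorm_shift_sub_le {p : ℝ≥0∞} (hp : 1 ≤ p) (A : SmoothPer d) (y : Space d) :
    eLpNorm (fun x => (A : Space d → ℂ) (x - y) - (A : Space d → ℂ) x) p
      (volume.restrict (cell d)) ≤ ‖y‖ₑ * gradENorm p A := by
  let D : Fin d → SmoothPer d := fun i => dirDeriv (EuclideanSpace.single i (1 : ℝ)) A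
  let g : Space d → ℝ := fun x => ∑ i, ‖(D i : Space d → ℂ) x‖
  have hD : ∀ i, Continuous (D i : Space d → ℂ) := fun i => continuous_coe (D i)
  have hg : Continuous g := by fun_prop
  have hgper : ∀ n x, g (x + latticeVec n) = g x := fun n x => by simp only [g, (D _).2.2]
  have hgn : eLpNorm g p (volume.restrict (cell d)) ≤ gradENorm p A := by
    have e : g = ∑ i, fun x => ‖(D i : Space d → ℂ) x‖ := by ext x; simp [g]
    rw [e]
    refine (eLpNorm_sum_le (fun i _ => (hD i).norm.aestronglyMeasurable) hp).trans_eq ?_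
    simp only [eLpNorm_norm]
    rfl
  have h := eLpNorm_le_of_enorm_le_lintegral (μ := volume.restrict (cell d))
    (ν := (volume : Measure ℝ).restrict (Set.Ioc 0 1)) hp
    (h := fun x => (A : Space d → ℂ) (x - y) - (A : Space d → ℂ) x)
    (G := fun x s => ‖y‖ • g (x - s • y)) (M := ‖y‖ₑ * gradENorm p A) (by fun_prop)
    (fun s => by
      have := eLpNorm_const_smul (p := p) (μ := volume.restrict (cell d)) ‖y‖
        (fun x => g (x - s • y))
      rw [eLpNorm_cell_comp_sub hg hgper, enorm_norm] at this
      exact this.trans_le (mul_le_mul_right hgn _))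
    (fun x => by
      have hd : ∀ s ∈ Set.uIcc (0 : ℝ) 1,
          HasDerivAt (fun s : ℝ => (A : Space d → ℂ) (x - s • y))
            (fderiv ℝ (A : Space d → ℂ) (x - s • y) (-y)) s := by
        intro s _
        have h1 : HasDerivAt (fun s : ℝ => x - s • y) (-y) s := by
          simpa using ((hasDerivAt_id s).smul_const y).const_sub x
        exact (hasFDerivAt_coe A (x - s • y)).comp_hasDerivAt s h1
      have hc' : Continuous (fderiv ℝ (A : Space d → ℂ)) := A.2.1.continuous_fderiv (by simp)
      have hi := intervalIntegral.integral_eq_sub_of_hasDerivAt hd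
        (Continuous.intervalIntegrable (by fun_prop) _ _)
      simp only [one_smul, zero_smul, sub_zero] at hi
      rw [← hi, intervalIntegral.integral_of_le zero_le_one]
      refine (enorm_integral_le_lintegral_enorm _).trans (lintegral_mono fun s => ?_)
      rw [← ofReal_norm, ← ofReal_norm]
      refine ENNReal.ofReal_le_ofReal ?_
      have hg0 : 0 ≤ g (x - s • y) := Finset.sum_nonneg fun _ _ => norm_nonneg _
      rw [norm_smul, norm_norm, Real.norm_of_nonneg hg0, mul_comm, ← norm_neg y]
      exact (ContinuousLinearMap.le_opNorm _ _).trans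
        (mul_le_mul_of_nonneg_right (norm_clm_le_sum _) (norm_nonneg _)))
  simpa using h

/-- The increment of `A` gains a factor `|y|`, so the first moment of `K` appears in place of its
mass. Minkowski is applied with the measure `|y||K(y)| dy` to the difference quotient of `A` times
the translate of `B`, whose slices are bounded by Hölder. -/
lemma eLpNorm_conv_commutator_le {p p₁ p₂ : ℝ≥0∞} (hp : 1 ≤ p) (hp₁ : 1 ≤ p₁)
    (hpp : p⁻¹ = p₁⁻¹ + p₂⁻¹) {K : Space d → ℂ} (hK : Integrable K)
    (hK' : Integrable fun y => ‖y‖ * ‖K y‖) (A B : SmoothPer d) :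
    eLpNorm (fun x => conv K (mulPer A B) x - (A : Space d → ℂ) x * conv K B x) p
      (volume.restrict (cell d)) ≤ ENNReal.ofReal (∫ y, ‖y‖ * ‖K y‖) *
        (gradENorm p₁ A * eLpNorm (B : Space d → ℂ) p₂ (volume.restrict (cell d))) := by
  have hA := continuous_coe A
  have hB := continuous_coe B
  have : ENNReal.HolderTriple p₁ p₂ p := ⟨hpp.symm⟩
  have h := eLpNorm_le_of_enorm_le_lintegral (μ := volume.restrict (cell d))
    (ν := volume.withDensity fun y => ‖‖y‖ * ‖K y‖‖ₑ) hp
    (h := fun x => conv K (mulPer A B) x - (A : Space d → ℂ) x * conv K B x)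
    -- At `y = 0` the inverse is `0` by convention, which is harmless because the increment vanishes
    -- there.
    (G := fun x y => ‖y‖⁻¹ •
      (((A : Space d → ℂ) (x - y) - (A : Space d → ℂ) x) • (B : Space d → ℂ) (x - y)))
    (M := gradENorm p₁ A * eLpNorm (B : Space d → ℂ) p₂ (volume.restrict (cell d)))
    (by fun_prop)
    (fun y => by
      have h1 := eLpNorm_const_smul (p := p) (μ := volume.restrict (cell d)) ‖y‖⁻¹
        (fun x => ((A : Space d → ℂ) (x - y) - (A : Space d → ℂ) x) • (B : Space d → ℂ) (x - y))
      have h2 := eLpNorm_smul_le_mul_eLpNorm (p := p₁) (q := p₂) (r := p)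
        (μ := volume.restrict (cell d)) (f := fun x => (B : Space d → ℂ) (x - y))
        (φ := fun x => (A : Space d → ℂ) (x - y) - (A : Space d → ℂ) x)
        (Continuous.aestronglyMeasurable (by fun_prop))
        (Continuous.aestronglyMeasurable (by fun_prop))
      rw [eLpNorm_cell_comp_sub hB B.2.2] at h2
      refine h1.trans_le ((mul_le_mul_right (h2.trans
        (mul_le_mul_left (eLpNorm_shift_sub_le hp₁ A y) _)) _).trans ?_)
      rw [mul_assoc, ← mul_assoc]
      refine mul_le_of_le_one_left' ?_
      by_cases hy : y = 0
      · simp [hy]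
      · rw [← enorm_norm y, ← enorm_mul, inv_mul_cancel₀ (norm_ne_zero_iff.2 hy)]
        simp)
    (fun x => by
      obtain ⟨CA, hCA⟩ := exists_bound (mulPer A B)
      obtain ⟨CB, hCB⟩ := exists_bound B
      have e : conv K (mulPer A B) x - (A : Space d → ℂ) x * conv K B x =
          ∫ y, K y * (((A : Space d → ℂ) (x - y) - (A : Space d → ℂ) x) *
            (B : Space d → ℂ) (x - y)) := by
        rw [conv, conv, ← integral_const_mul, ← integral_sub
          (integrable_mul_comp_sub hK (continuous_coe _) hCA x)
          ((integrable_mul_comp_sub hK hB hCB x).const_mul _)]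
        congr 1
        ext y
        simp only [mulPer]
        ring
      rw [e, lintegral_withDensity_eq_lintegral_mul₀ hK'.aestronglyMeasurable.enorm (by fun_prop)]
      refine (enorm_integral_le_lintegral_enorm _).trans (lintegral_mono fun y => ?_)
      simp only [Pi.mul_apply, enorm_mul, enorm_smul, enorm_norm]
      by_cases hy : y = 0
      · simp [hy]
      · have h1 : ‖y‖ₑ * ‖‖y‖⁻¹‖ₑ = 1 := by
          rw [← enorm_norm y, ← enorm_mul, mul_inv_cancel₀ (norm_ne_zero_iff.2 hy)]
          simp
        rw [mul_mul_mul_comm, h1, one_mul])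
  rw [withDensity_apply _ MeasurableSet.univ, Measure.restrict_univ,
    ← ofReal_integral_norm_eq_lintegral_enorm hK', mul_comm] at h
  simpa only [norm_mul, norm_norm] using h

/-! ### Spectral localization of products -/

lemma norm_exp_neg_I_mul (r : ℝ) : ‖Complex.exp (-(Complex.I * r))‖ = 1 := by
  rw [show -(Complex.I * (r : ℂ)) = ((-r : ℝ) : ℂ) * Complex.I by push_cast; ring,
    Complex.norm_exp_ofReal_mul_I]

lemma norm_exp_I_mul (r : ℝ) : ‖Complex.exp (Complex.I * r)‖ = 1 := by
  rw [mul_comm, Complex.norm_exp_ofReal_mul_I]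

/-- Expand both kernels by Fourier inversion and integrate in `y` first: the inner integral is the
symbol of `K` at `ξ + η`, which vanishes wherever the product of the two symbols does not. -/
lemma integral_mul_mulKernel_eq_zero {K : Space d → ℂ} (hK : Integrable K)
    (h₁ h₂ : 𝓢(Space d, ℂ)) {l₁ l₂ : ℝ} (hl₁ : 0 < l₁) (hl₂ : 0 < l₂)
    (H : ∀ ξ η, h₁ (l₁⁻¹ • ξ) ≠ 0 → h₂ (l₂⁻¹ • η) ≠ 0 → convSymbol K (ξ + η) = 0)
    (a b : Space d) :
    ∫ y, K y * (mulKernel h₁ l₁ (a - y) * mulKernel h₂ l₂ (b - y)) = 0 := by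
  have i₁ : Integrable fun ξ : Space d => h₁ (l₁⁻¹ • ξ) :=
    (integrable_comp_smul_iff volume _ (inv_ne_zero hl₁.ne')).2 h₁.integrable
  have i₂ : Integrable fun ξ : Space d => h₂ (l₂⁻¹ • ξ) :=
    (integrable_comp_smul_iff volume _ (inv_ne_zero hl₂.ne')).2 h₂.integrable
  set c : ℂ := (((2 * Real.pi) ^ d : ℝ) : ℂ)⁻¹
  let E : Space d → Space d → ℂ := fun y ξ => Complex.exp (Complex.I * (inner ℝ y ξ : ℝ))
  have hE : ∀ y ξ, ‖E y ξ‖ = 1 := fun y ξ => norm_exp_I_mul _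
  have e : ∀ y, K y * (mulKernel h₁ l₁ (a - y) * mulKernel h₂ l₂ (b - y)) =
      c ^ 2 * ∫ z : Space d × Space d, K y * ((h₁ (l₁⁻¹ • z.1) * h₂ (l₂⁻¹ • z.2)) *
        (E (a - y) z.1 * E (b - y) z.2)) := by
    intro y
    rw [mulKernel_eq h₁ hl₁, mulKernel_eq h₂ hl₂, mul_mul_mul_comm, ← integral_prod_mul,
      ← sq, mul_left_comm, ← integral_const_mul]
    congr 2
    ext z
    simp only [E]
    ring
  simp only [e]
  rw [integral_const_mul]
  have hi : Integrable (fun w : Space d × (Space d × Space d) =>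
      K w.1 * ((h₁ (l₁⁻¹ • w.2.1) * h₂ (l₂⁻¹ • w.2.2)) * (E (a - w.1) w.2.1 * E (b - w.1) w.2.2)))
      (volume.prod (volume.prod volume)) := by
    have := (hK.mul_prod (i₁.mul_prod i₂)).mul_bdd (c := 1)
      (g := fun w : Space d × (Space d × Space d) => E (a - w.1) w.2.1 * E (b - w.1) w.2.2)
      (Continuous.aestronglyMeasurable (by fun_prop))
      (Filter.Eventually.of_forall fun w => by rw [norm_mul, hE, hE, one_mul])
    simpa only [mul_assoc] using this
  rw [integral_integral_swap (μ := volume) (ν := (volume : Measure (Space d × Space d))) (f := fun y (z : Space d × Space d) =>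
    K y * ((h₁ (l₁⁻¹ • z.1) * h₂ (l₂⁻¹ • z.2)) * (E (a - y) z.1 * E (b - y) z.2))) hi]
  rw [integral_eq_zero_of_ae, mul_zero]
  refine Filter.Eventually.of_forall fun z => ?_
  have hz : ∀ y, K y * ((h₁ (l₁⁻¹ • z.1) * h₂ (l₂⁻¹ • z.2)) * (E (a - y) z.1 * E (b - y) z.2)) =
      (h₁ (l₁⁻¹ • z.1) * h₂ (l₂⁻¹ • z.2)) * (E a z.1 * E b z.2) *
        (K y * Complex.exp (-(Complex.I * (inner ℝ y (z.1 + z.2) : ℝ)))) := by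
    intro y
    have : E (a - y) z.1 * E (b - y) z.2 = E a z.1 * E b z.2 *
        Complex.exp (-(Complex.I * (inner ℝ y (z.1 + z.2) : ℝ))) := by
      simp only [E, ← Complex.exp_add, inner_sub_left, inner_add_right]
      congr 1
      push_cast
      ring
    rw [this]
    ring
  simp only [hz, integral_const_mul, Pi.zero_apply]
  change _ * convSymbol K (z.1 + z.2) = 0
  by_cases h1 : h₁ (l₁⁻¹ • z.1) = 0
  · simp [h1]
  by_cases h2 : h₂ (l₂⁻¹ • z.2) = 0
  · simp [h2]
  rw [H _ _ h1 h2, mul_zero]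

/-- The spectrum of a product lies in the sum of the spectra. Shifting the integration variables
moves the dependence on `y` from `f` and `g` to the kernels, so Fubini isolates the integral that
the previous lemma annihilates. -/
lemma conv_mul_conv_eq_zero {K : Space d → ℂ} (hK : Integrable K)
    (h₁ h₂ : 𝓢(Space d, ℂ)) {l₁ l₂ : ℝ} (hl₁ : 0 < l₁) (hl₂ : 0 < l₂)
    (H : ∀ ξ η, h₁ (l₁⁻¹ • ξ) ≠ 0 → h₂ (l₂⁻¹ • η) ≠ 0 → convSymbol K (ξ + η) = 0)
    (f g : SmoothPer d) (x : Space d) :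
    conv K (fun x => conv (mulKernel h₁ l₁) f x * conv (mulKernel h₂ l₂) g x) x = 0 := by
  obtain ⟨Cf, hCf⟩ := exists_bound f
  obtain ⟨Cg, hCg⟩ := exists_bound g
  have hf := continuous_coe f
  have hg := continuous_coe g
  have hc₁ := continuous_mulKernel h₁ l₁
  have hc₂ := continuous_mulKernel h₂ l₂
  set M₁ := mulKernel h₁ l₁ with hM₁
  set M₂ := mulKernel h₂ l₂ with hM₂
  have i₁ : Integrable M₁ := integrable_mulKernel h₁ hl₁
  have i₂ : Integrable M₂ := integrable_mulKernel h₂ hl₂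
  have shift : ∀ (M F : Space d → ℂ) y, conv M F (x - y) = ∫ a, M (a - y) * F (x - a) := by
    intro M F y
    rw [conv, ← integral_sub_right_eq_self _ y]
    simp only [sub_sub_sub_cancel_right]
  have e : ∀ y, K y * (conv M₁ f (x - y) * conv M₂ g (x - y)) =
      ∫ z : Space d × Space d, K y * ((M₁ (z.1 - y) * M₂ (z.2 - y)) *
        ((f : Space d → ℂ) (x - z.1) * (g : Space d → ℂ) (x - z.2))) := by
    intro y
    rw [shift, shift, ← integral_prod_mul, ← integral_const_mul]
    congr 1
    ext z
    ring
  rw [conv]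
  simp only [e]
  have hprod : ∀ y, Integrable (fun z : Space d × Space d => M₁ (z.1 - y) * M₂ (z.2 - y))
      (volume.prod volume) := fun y => (i₁.comp_sub_right y).mul_prod (i₂.comp_sub_right y)
  have hi0 : Integrable (fun w : Space d × (Space d × Space d) =>
      K w.1 * (M₁ (w.2.1 - w.1) * M₂ (w.2.2 - w.1))) (volume.prod (volume.prod volume)) := by
    have hm : AEStronglyMeasurable (fun w : Space d × (Space d × Space d) =>
        M₁ (w.2.1 - w.1) * M₂ (w.2.2 - w.1)) (volume.prod (volume.prod volume)) :=
      Continuous.aestronglyMeasurable (by fun_prop)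
    refine (integrable_prod_iff (hK.aestronglyMeasurable.comp_fst.mul hm)).2 ?_
    refine ⟨Filter.Eventually.of_forall fun y => (hprod y).const_mul (K y), ?_⟩
    refine (hK.norm.mul_const ((∫ a, ‖M₁ a‖) * ∫ b, ‖M₂ b‖)).congr
      (Filter.Eventually.of_forall fun y => ?_)
    simp only [Pi.mul_apply, norm_mul, integral_const_mul]
    rw [integral_prod_mul (fun a => ‖M₁ (a - y)‖) (fun b => ‖M₂ (b - y)‖),
      integral_sub_right_eq_self (fun a => ‖M₁ a‖), integral_sub_right_eq_self (fun a => ‖M₂ a‖)]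
  have hi := hi0.mul_bdd (c := Cf * Cg)
    (g := fun w => (f : Space d → ℂ) (x - w.2.1) * (g : Space d → ℂ) (x - w.2.2))
    (Continuous.aestronglyMeasurable (by fun_prop))
    (Filter.Eventually.of_forall fun w => by
      rw [norm_mul]
      exact mul_le_mul (hCf _) (hCg _) (norm_nonneg _) ((norm_nonneg _).trans (hCf 0)))
  simp only [mul_assoc] at hi
  simp only [mul_assoc]
  rw [integral_integral_swap (μ := volume) (ν := (volume : Measure (Space d × Space d))) (f := fun y (z : Space d × Space d) =>
    K y * (M₁ (z.1 - y) * (M₂ (z.2 - y) *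
        ((f : Space d → ℂ) (x - z.1) * (g : Space d → ℂ) (x - z.2))))) hi]
  refine integral_eq_zero_of_ae (Filter.Eventually.of_forall fun z => ?_)
  have hz : ∀ y, K y * (M₁ (z.1 - y) * (M₂ (z.2 - y) *
      ((f : Space d → ℂ) (x - z.1) * (g : Space d → ℂ) (x - z.2)))) =
      ((f : Space d → ℂ) (x - z.1) * (g : Space d → ℂ) (x - z.2)) *
        (K y * (M₁ (z.1 - y) * M₂ (z.2 - y))) := fun y => by ring
  simp only [hz, integral_const_mul]
  rw [integral_mul_mulKernel_eq_zero hK h₁ h₂ hl₁ hl₂ H, mul_zero]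
  rfl

lemma norm_lt_of_symbol_ne_zero (P : DyadicPartition d) {i : ℤ} {ξ : Space d}
    (h : symbol P i ξ ≠ 0) : ‖ξ‖ < (2 : ℝ) ^ i * (8 / 3) := by
  rw [symbol] at h
  split_ifs at h with hi
  · subst hi
    have := P.low_supp (subset_tsupport _ h)
    rw [mem_ball_zero_iff] at this
    norm_num
    linarith
  · have := (P.bump_supp (subset_tsupport _ h)).1
    have h2 : (0 : ℝ) < 2 ^ i := by positivity
    rw [mem_ball_zero_iff, norm_smul, norm_inv, Real.norm_of_nonneg h2.le,
      inv_mul_lt_iff₀ h2] at this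
    exact this

lemma le_norm_of_symbol_ne_zero (P : DyadicPartition d) {i : ℤ} (hi : i ≠ -1) {ξ : Space d}
    (h : symbol P i ξ ≠ 0) : (2 : ℝ) ^ i * (3 / 4) ≤ ‖ξ‖ := by
  rw [symbol, if_neg hi] at h
  have := (P.bump_supp (subset_tsupport _ h)).2
  have h2 : (0 : ℝ) < 2 ^ i := by positivity
  rw [mem_ball_zero_iff, not_lt, norm_smul, norm_inv, Real.norm_of_nonneg h2.le,
    le_inv_mul_iff₀ h2] at this
  exact this

/-- For `i ≤ k - 2` the lower frequency is below `(1/4)(8/3) = 2/3` in units of `2^k`, the higher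
one between `3/4` and `8/3`. The sum then has norm between `3/4 - 2/3 = 1/12` and `8/3 + 2/3 =
10/3`. -/
lemma conv_block_mul_block_eq_zero (P : DyadicPartition d) {K : Space d → ℂ} (hK : Integrable K)
    {i k : ℤ} (hk : 1 ≤ k) (hik : i ≤ k - 2)
    (H : ∀ ζ : Space d, (2 : ℝ) ^ k / 12 ≤ ‖ζ‖ → ‖ζ‖ ≤ (2 : ℝ) ^ k * (10 / 3) →
      convSymbol K ζ = 0) (f g : SmoothPer d) (x : Space d) :
    conv K (fun x => block P i f x * block P k g x) x = 0 := by
  obtain ⟨h₁, l₁, hl₁, e₁, s₁⟩ := exists_kernel_eq P i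
  obtain ⟨h₂, l₂, hl₂, e₂, s₂⟩ := exists_kernel_eq P k
  simp only [block_eq_conv, e₁, e₂]
  refine conv_mul_conv_eq_zero hK h₁ h₂ hl₁ hl₂ (fun ξ η hξ hη => ?_) f g x
  rw [s₁, Complex.ofReal_ne_zero] at hξ
  rw [s₂, Complex.ofReal_ne_zero] at hη
  have n1 := norm_lt_of_symbol_ne_zero P hξ
  have n2 := norm_lt_of_symbol_ne_zero P hη
  have n3 := le_norm_of_symbol_ne_zero P (by omega) hη
  have n4 : (2 : ℝ) ^ i ≤ 2 ^ k / 4 := by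
    refine (zpow_le_zpow_right₀ one_le_two hik).trans_eq ?_
    rw [zpow_sub₀ two_ne_zero]
    norm_num
  refine H _ ?_ ?_
  · have := norm_sub_le (ξ + η) ξ
    rw [add_sub_cancel_left] at this
    linarith
  · have := norm_add_le ξ η
    linarith

lemma conv_finset_sum {ι : Type*} {K : Space d → ℂ} (hK : Integrable K) (s : Finset ι)
    (F : ι → SmoothPer d) (x : Space d) :
    conv K (fun x => ∑ i ∈ s, (F i : Space d → ℂ) x) x = ∑ i ∈ s, conv K (F i) x := by
  simp only [conv, Finset.mul_sum]
  exact integral_finsetSum _ fun i _ =>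
    integrable_mul_comp_sub hK (continuous_coe _) (exists_bound (F i)).choose_spec x

lemma conv_lowPart_mul_block_eq_zero (P : DyadicPartition d) {K : Space d → ℂ}
    (hK : Integrable K) {k : ℤ} (hk : 1 ≤ k)
    (H : ∀ ζ : Space d, (2 : ℝ) ^ k / 12 ≤ ‖ζ‖ → ‖ζ‖ ≤ (2 : ℝ) ^ k * (10 / 3) →
      convSymbol K ζ = 0) (f g : SmoothPer d) (x : Space d) :
    conv K (mulPer (lowPer P (k - 1) f) (blockPer P k g)) x = 0 := by
  have e : (mulPer (lowPer P (k - 1) f) (blockPer P k g) : Space d → ℂ) = fun x =>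
      ∑ i ∈ Finset.Ico (-1) (k - 1),
        (mulPer (blockPer P i f) (blockPer P k g) : Space d → ℂ) x := by
    ext x
    simp only [mulPer, coe_lowPer, coe_blockPer, lowPart, Finset.sum_mul]
  rw [e, conv_finset_sum hK]
  refine Finset.sum_eq_zero fun i hi => ?_
  exact conv_block_mul_block_eq_zero P hK hk (by have := Finset.mem_Ico.1 hi; omega) H f g x

/-- The constant function `1`. -/
def onePer (d : ℕ) : SmoothPer d := ⟨fun _ => 1, contDiff_const, fun _ _ => rfl⟩

/-- The integral of the kernel is `χ̃(0)`, and this is `1` because every dyadic bump vanishes at the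
origin. -/
lemma block_neg_one_onePer (P : DyadicPartition d) (x : Space d) :
    block P (-1) (onePer d) x = 1 := by
  have h := convSymbol_kernel P (-1) 0
  have h1 : P.low 0 = 1 := by
    have h2 : P.bump 0 = 0 := by
      by_contra h
      have := (P.bump_supp (subset_tsupport _ h)).2
      norm_num at this
    have := (P.sum_eq_one 0).unique (a₂ := 0) (by simp [h2])
    linarith
  simp only [convSymbol, inner_zero_right, symbol, if_true, h1] at h
  simpa [block, onePer] using h

lemma conv_block_eq_zero (P : DyadicPartition d) {K : Space d → ℂ}
    (hK : Integrable K) {k : ℤ} (hk : 1 ≤ k)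
    (H : ∀ ζ : Space d, (2 : ℝ) ^ k / 12 ≤ ‖ζ‖ → ‖ζ‖ ≤ (2 : ℝ) ^ k * (10 / 3) →
      convSymbol K ζ = 0) (g : SmoothPer d) (x : Space d) :
    conv K (block P k g) x = 0 := by
  -- A single block is its product with `δ_{-1} 1 = 1`; the index `-1` is admissible exactly because
  -- `k ≥ 1`.
  have := conv_block_mul_block_eq_zero P hK hk (i := -1) (by omega) H (onePer d) g x
  simpa only [block_neg_one_onePer, one_mul] using this

lemma block_lowPart_mul_block_eq_zero (P : DyadicPartition d) {j k : ℤ}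
    (hk : 1 ≤ k) (hjk : j < k - 4 ∨ k + 2 < j) (f g : SmoothPer d) (x : Space d) :
    block P j (mulPer (lowPer P (k - 1) f) (blockPer P k g)) x = 0 := by
  rw [block_eq_conv]
  refine conv_lowPart_mul_block_eq_zero P (integrable_kernel P j) hk (fun ζ h1 h2 => ?_) f g x
  rw [convSymbol_kernel, Complex.ofReal_eq_zero]
  by_contra h
  have n1 := norm_lt_of_symbol_ne_zero P h
  have hk0 : (0 : ℝ) < 2 ^ k := by positivity
  rcases hjk with hjk | hjk
  -- `(8/3)/32 = 1/12`: the block `j` lies just below the annulus.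
  · have : (2 : ℝ) ^ j ≤ 2 ^ k / 32 := by
      refine (zpow_le_zpow_right₀ one_le_two (show j ≤ k - 5 by omega)).trans_eq ?_
      rw [zpow_sub₀ two_ne_zero]
      norm_num
    linarith
  -- `8·(3/4) = 6` exceeds `10/3`, whereas one step less would give only `3`.
  · have n2 := le_norm_of_symbol_ne_zero P (by omega) h
    have : (2 : ℝ) ^ k * 8 ≤ 2 ^ j := by
      refine le_trans (le_of_eq ?_) (zpow_le_zpow_right₀ one_le_two (show k + 3 ≤ j by omega))
      rw [zpow_add₀ two_ne_zero]
      norm_num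
    linarith

/-! ### Localized heat kernels -/

/-- The first moment of the inverse Fourier transform. -/
noncomputable def invMoment (h : 𝓢(Space d, ℂ)) : ℝ := ∫ w, ‖w‖ * ‖(𝓕⁻ h) w‖

/-- The first moment is controlled by two decay seminorms of `𝓕⁻ h`, and `𝓕⁻` is continuous on
Schwartz space. -/
lemma exists_invMoment_le_seminorm : ∃ (s : Finset (ℕ × ℕ)) (C : ℝ), 0 ≤ C ∧
    ∀ h : 𝓢(Space d, ℂ), invMoment h ≤ C * (s.sup (schwartzSeminormFamily ℂ (Space d) ℂ)) h := by
  have key : ∀ i, ∃ (s : Finset (ℕ × ℕ)) (C : NNReal), ∀ h : 𝓢(Space d, ℂ),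
      schwartzSeminormFamily ℂ (Space d) ℂ i (𝓕⁻ h) ≤
        C * (s.sup (schwartzSeminormFamily ℂ (Space d) ℂ)) h := by
    intro i
    let L := FourierTransform.fourierInvCLM ℂ 𝓢(Space d, ℂ) (F := 𝓢(Space d, ℂ))
    obtain ⟨s, C, -, hC⟩ := Seminorm.bound_of_continuous
      (schwartz_withSeminorms ℂ (Space d) ℂ)
      ((schwartzSeminormFamily ℂ (Space d) ℂ i).comp L.toLinearMap)
      (((schwartz_withSeminorms ℂ (Space d) ℂ).continuous_seminorm i).comp L.continuous)
    exact ⟨s, C, fun h => hC h⟩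
  let m := (volume : Measure (Space d)).integrablePower
  obtain ⟨s₁, C₁, h₁⟩ := key (0, 0)
  obtain ⟨s₂, C₂, h₂⟩ := key (1 + m, 0)
  set c := 2 ^ m * ∫ x : Space d, (1 + ‖x‖) ^ (-(m : ℝ)) with hc
  have hc0 : 0 ≤ c := mul_nonneg (by positivity)
    (integral_nonneg fun x => Real.rpow_nonneg (by positivity) _)
  refine ⟨s₁ ∪ s₂, c * (C₁ + C₂), by positivity, fun h => ?_⟩
  have := SchwartzMap.integral_pow_mul_iteratedFDeriv_le ℂ volume (𝓕⁻ h) 1 0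
  simp only [pow_one, norm_iteratedFDeriv_zero] at this
  refine this.trans ?_
  rw [mul_assoc c]
  refine mul_le_mul_of_nonneg_left ?_ hc0
  rw [add_mul]
  refine add_le_add ((h₁ h).trans ?_) ((h₂ h).trans ?_)
  · exact mul_le_mul_of_nonneg_left (Seminorm.le_def.1 (Finset.sup_mono Finset.subset_union_left) h)
      C₁.2
  · exact mul_le_mul_of_nonneg_left (Seminorm.le_def.1 (Finset.sup_mono Finset.subset_union_right) h)
      C₂.2

/-- Compactness supplies the uniformity in the parameter: derivatives of the slices are bounded by
joint derivatives of `F`, which are bounded on `[0,1]` times the closed ball of radius `4`. -/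
lemma exists_invMoment_bound_of_family {F : ℝ × Space d → ℂ} (hF : ContDiff ℝ ∞ F)
    (hF0 : ∀ σ ζ, 4 ≤ ‖ζ‖ → F (σ, ζ) = 0) : ∃ C, ∀ σ ∈ Set.Icc (0 : ℝ) 1,
      ∀ h : 𝓢(Space d, ℂ), (∀ ζ, h ζ = F (σ, ζ)) → invMoment h ≤ C := by
  have bound : ∀ i : ℕ × ℕ, ∃ M : ℝ, 0 ≤ M ∧ ∀ σ ∈ Set.Icc (0 : ℝ) 1,
      ∀ h : 𝓢(Space d, ℂ), (∀ ζ, h ζ = F (σ, ζ)) →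
        schwartzSeminormFamily ℂ (Space d) ℂ i h ≤ M := by
    rintro ⟨k, n⟩
    have hcont : Continuous fun z : ℝ × Space d => ‖z.2‖ ^ k * ‖iteratedFDeriv ℝ n F z‖ :=
      (continuous_snd.norm.pow k).mul
        (hF.continuous_iteratedFDeriv (m := n) (by exact_mod_cast le_top)).norm
    obtain ⟨M, hM⟩ := (isCompact_Icc.prod (isCompact_closedBall (0 : Space d) 4)).bddAbove_image
      (f := fun z : ℝ × Space d => ‖z.2‖ ^ k * ‖iteratedFDeriv ℝ n F z‖) hcont.continuousOn
    refine ⟨max M 0, le_max_right _ _, fun σ hσ h hh => ?_⟩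
    refine SchwartzMap.seminorm_le_bound ℂ k n h (le_max_right _ _) fun x => ?_
    by_cases hx : x ∈ Metric.closedBall (0 : Space d) 4
    · refine le_max_of_le_left (le_trans ?_ (hM ⟨(σ, x), ⟨hσ, hx⟩, rfl⟩))
      refine mul_le_mul_of_nonneg_left ?_ (by positivity)
      have e : (h : Space d → ℂ) =
          (fun z => F ((σ, 0) + z)) ∘ ContinuousLinearMap.inr ℝ ℝ (Space d) := by
        ext ζ
        simp [hh]
      have hF' : ContDiff ℝ ∞ fun z => F ((σ, 0) + z) :=
        hF.comp (contDiff_const.add contDiff_id)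
      rw [e, ContinuousLinearMap.iteratedFDeriv_comp_right _ hF' _ (by exact_mod_cast le_top),
        iteratedFDeriv_comp_add_left]
      refine (ContinuousMultilinearMap.norm_compContinuousLinearMap_le _ _).trans ?_
      simp only [ContinuousLinearMap.inr_apply, Prod.mk_add_mk, add_zero, zero_add,
        Finset.prod_const]
      exact mul_le_of_le_one_right (norm_nonneg _) (pow_le_one₀ (norm_nonneg _)
        (ContinuousLinearMap.norm_inr_le_one ℝ ℝ (Space d)))
    · have hs : tsupport (h : Space d → ℂ) ⊆ Metric.closedBall (0 : Space d) 4 := by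
        refine closure_minimal (fun ζ hζ => ?_) Metric.isClosed_closedBall
        rw [mem_closedBall_zero_iff]
        by_contra! h4
        exact hζ (by rw [hh, hF0 _ _ h4.le])
      have : iteratedFDeriv ℝ n h x = 0 := by
        by_contra h0
        exact hx (hs (support_iteratedFDeriv_subset n h0))
      rw [this]
      simp
  choose M hM0 hM using bound
  obtain ⟨s, C, hC0, hC⟩ := exists_invMoment_le_seminorm (d := d)
  refine ⟨C * ∑ i ∈ s, M i, fun σ hσ h hh => (hC h).trans (mul_le_mul_of_nonneg_left ?_ hC0)⟩
  refine Seminorm.finset_sup_apply_le (Finset.sum_nonneg fun i _ => hM0 i) fun i hi => ?_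
  exact (hM i σ hσ h hh).trans (Finset.single_le_sum (fun i _ => hM0 i) hi)

variable (d) in
-- The plateau is the annulus containing the rescaled spectra of the shells. Vanishing near the
-- origin allows division by `‖ζ‖²`; the radii `1/20` and `4` are otherwise arbitrary.
lemma exists_annulus_cutoff : ∃ φ : Space d → ℝ, ContDiff ℝ ∞ φ ∧
    (∀ ζ, 1 / 12 ≤ ‖ζ‖ → ‖ζ‖ ≤ 10 / 3 → φ ζ = 1) ∧ (∀ ζ, 4 ≤ ‖ζ‖ → φ ζ = 0) ∧
    ∀ ζ, ‖ζ‖ ≤ 1 / 20 → φ ζ = 0 := by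
  let b₁ : ContDiffBump (0 : Space d) := ⟨10 / 3, 4, by norm_num, by norm_num⟩
  let b₂ : ContDiffBump (0 : Space d) := ⟨1 / 20, 1 / 12, by norm_num, by norm_num⟩
  refine ⟨fun ζ => b₁ ζ * (1 - b₂ ζ), b₁.contDiff.mul (contDiff_const.sub b₂.contDiff),
    fun ζ h1 h2 => ?_, fun ζ h => ?_, fun ζ h => ?_⟩
  · change b₁ ζ * (1 - b₂ ζ) = 1
    rw [b₁.one_of_mem_closedBall (mem_closedBall_zero_iff.2 h2),
      b₂.zero_of_le_dist (by rwa [dist_zero_right])]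
    norm_num
  · change b₁ ζ * (1 - b₂ ζ) = 0
    rw [b₁.zero_of_le_dist (by rwa [dist_zero_right]), zero_mul]
  · change b₁ ζ * (1 - b₂ ζ) = 0
    rw [b₂.one_of_mem_closedBall (mem_closedBall_zero_iff.2 h), sub_self, mul_zero]

/-- A compactly supported smooth function as a Schwartz function. -/
lemma exists_schwartz_eq {f : Space d → ℂ} (hf : ContDiff ℝ ∞ f) (hf0 : ∀ ζ, 4 ≤ ‖ζ‖ → f ζ = 0) :
    ∃ h : 𝓢(Space d, ℂ), ∀ ζ, h ζ = f ζ := by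
  have hc : HasCompactSupport f :=
    HasCompactSupport.intro (isCompact_closedBall (0 : Space d) 4) fun ζ hζ =>
      hf0 ζ (by rw [mem_closedBall_zero_iff, not_le] at hζ; exact hζ.le)
  exact ⟨hc.toSchwartzMap hf, fun ζ => rfl⟩

/-- For `σ = z.1 > 0` and `ζ = z.2 ≠ 0` the function is `φ(ζ) σ^{-M} exp(-|ζ|²/σ)`. Written through
`expNegInvGlue` it extends smoothly across `σ = 0`, which makes the regime of large heat times a
compact one. -/
lemma contDiff_cutoff_expNegInvGlue {φ : Space d → ℝ} (hφ : ContDiff ℝ ∞ φ)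
    (hφ0 : ∀ ζ, ‖ζ‖ ≤ 1 / 20 → φ ζ = 0) (M : ℕ) :
    ContDiff ℝ ∞ fun z : ℝ × Space d => φ z.2 * ((‖z.2‖ ^ 2)⁻¹ ^ M *
      ((z.1 * (‖z.2‖ ^ 2)⁻¹)⁻¹ ^ M * expNegInvGlue (z.1 * (‖z.2‖ ^ 2)⁻¹))) := by
  have hE : ContDiff ℝ ∞ fun x : ℝ => x⁻¹ ^ M * expNegInvGlue x := by
    simpa using! expNegInvGlue.contDiff_polynomial_eval_inv_mul (n := ⊤) (Polynomial.X ^ M)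
  rw [contDiff_iff_contDiffAt]
  rintro ⟨σ, ζ⟩
  by_cases hζ : ζ = 0
  · subst hζ
    refine (contDiffAt_const (c := (0 : ℝ))).congr_of_eventuallyEq ?_
    have : ∀ᶠ z : ℝ × Space d in nhds (σ, 0), ‖z.2‖ < 1 / 20 :=
      (continuous_snd.norm.tendsto (σ, (0 : Space d))).eventually_lt_const (by simp)
    filter_upwards [this] with z hz
    rw [hφ0 _ hz.le, zero_mul]
  · have hn : ContDiffAt ℝ ∞ (fun z : ℝ × Space d => (‖z.2‖ ^ 2)⁻¹) (σ, ζ) :=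
      (((contDiff_norm_sq ℝ).comp contDiff_snd).contDiffAt).inv (by simpa using hζ)
    refine (hφ.comp contDiff_snd).contDiffAt.mul ((hn.pow M).mul ?_)
    exact hE.contDiffAt.comp (f := fun z : ℝ × Space d => z.1 * (‖z.2‖ ^ 2)⁻¹) (σ, ζ)
      (contDiff_fst.contDiffAt.mul hn)

lemma invMoment_smul (c : ℝ) (hc : 0 ≤ c) (h : 𝓢(Space d, ℂ)) :
    invMoment ((c : ℂ) • h) = c * invMoment h := by
  rw [invMoment, invMoment, ← integral_const_mul]
  have : 𝓕⁻ ((c : ℂ) • h) = (c : ℂ) • 𝓕⁻ h :=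
    map_smul (FourierTransform.fourierInvCLM ℂ 𝓢(Space d, ℂ)) (c : ℂ) h
  simp only [this, smul_apply, norm_smul, Complex.norm_real, Real.norm_of_nonneg hc]
  congr 1
  ext w
  ring

variable (d) in
-- For `τ ≤ 1` the symbols form a smooth family on a compact parameter interval, and `τ^{-N} ≥ 1`.
-- For `τ ≥ 1` the parameter becomes `σ = 1/τ`; exponential decay on the annulus absorbs a factor
-- `τ^M` with an integer `M ≥ N`.
lemma exists_localized_heat {N : ℝ} (hN : 0 ≤ N) : ∃ C : ℝ, 0 ≤ C ∧ ∀ τ : ℝ, 0 < τ →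
    ∃ h : 𝓢(Space d, ℂ),
      (∀ ζ, 1 / 12 ≤ ‖ζ‖ → ‖ζ‖ ≤ 10 / 3 → h ζ = Real.exp (-τ * ‖ζ‖ ^ 2)) ∧
      invMoment h ≤ C * τ ^ (-N) := by
  obtain ⟨φ, hφ, hφ1, hφ4, hφ0⟩ := exists_annulus_cutoff d
  obtain ⟨M, hM⟩ := exists_nat_ge N
  have hexp : ContDiff ℝ ∞ fun z : ℝ × Space d => φ z.2 * Real.exp (-z.1 * ‖z.2‖ ^ 2) :=
    (hφ.comp contDiff_snd).mul
      (contDiff_fst.neg.mul ((contDiff_norm_sq ℝ).comp contDiff_snd)).exp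
  obtain ⟨C₁, hC₁⟩ := exists_invMoment_bound_of_family (Complex.ofRealCLM.contDiff.comp hexp)
    (fun σ ζ h => by simp [hφ4 ζ h])
  obtain ⟨C₂, hC₂⟩ := exists_invMoment_bound_of_family (Complex.ofRealCLM.contDiff.comp
    (contDiff_cutoff_expNegInvGlue hφ hφ0 M)) (fun σ ζ h => by simp [hφ4 ζ h])
  refine ⟨max (max C₁ C₂) 0, le_max_right _ _, fun τ hτ => ?_⟩
  rcases le_total τ 1 with h1 | h1
  · obtain ⟨h, hh⟩ := exists_schwartz_eq
      (f := fun ζ => ((φ ζ * Real.exp (-τ * ‖ζ‖ ^ 2) : ℝ) : ℂ))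
      (Complex.ofRealCLM.contDiff.comp (hexp.comp (contDiff_prodMk_right τ)))
      (fun ζ h => by simp [hφ4 ζ h])
    refine ⟨h, fun ζ h1 h2 => by rw [hh, hφ1 ζ h1 h2, one_mul], ?_⟩
    refine (hC₁ τ ⟨hτ.le, h1⟩ h hh).trans ?_
    refine ((le_max_left _ _).trans (le_max_left _ _)).trans
      (le_mul_of_one_le_right (le_max_right _ _) ?_)
    exact Real.one_le_rpow_of_pos_of_le_one_of_nonpos hτ h1 (by linarith)
  · obtain ⟨h, hh⟩ := exists_schwartz_eq
      (f := fun ζ => ((φ ζ * ((‖ζ‖ ^ 2)⁻¹ ^ M *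
        ((τ⁻¹ * (‖ζ‖ ^ 2)⁻¹)⁻¹ ^ M * expNegInvGlue (τ⁻¹ * (‖ζ‖ ^ 2)⁻¹))) : ℝ) : ℂ))
      (Complex.ofRealCLM.contDiff.comp
        ((contDiff_cutoff_expNegInvGlue hφ hφ0 M).comp (contDiff_prodMk_right τ⁻¹)))
      (fun ζ h => by simp [hφ4 ζ h])
    -- The family at `σ = 1/τ` is `φ(ζ) τ^M exp(-τ|ζ|²)`; dividing by `τ^M` restores the heat symbol
    -- and displays the decay.
    refine ⟨(((τ ^ M)⁻¹ : ℝ) : ℂ) • h, fun ζ h1 h2 => ?_, ?_⟩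
    · have hζ : 0 < ‖ζ‖ := by linarith
      rw [smul_apply, hh, hφ1 ζ h1 h2, smul_eq_mul, ← Complex.ofReal_mul,
        Complex.ofReal_inj, expNegInvGlue, if_neg (not_le.2 (by positivity)), ← mul_inv, inv_inv,
        mul_pow, inv_pow]
      have : (‖ζ‖ ^ 2) ^ M ≠ 0 := by positivity
      field_simp
    · rw [invMoment_smul _ (by positivity)]
      have hb := hC₂ τ⁻¹ ⟨by positivity, inv_le_one_of_one_le₀ h1⟩ h hh
      have hp : (τ ^ M)⁻¹ ≤ τ ^ (-N) := by
        rw [← Real.rpow_natCast, ← Real.rpow_neg hτ.le]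
        exact Real.rpow_le_rpow_of_exponent_le h1 (by linarith)
      calc _ ≤ (τ ^ M)⁻¹ * max (max C₁ C₂) 0 := mul_le_mul_of_nonneg_left
            (hb.trans ((le_max_right _ _).trans (le_max_left _ _))) (by positivity)
        _ ≤ τ ^ (-N) * max (max C₁ C₂) 0 := mul_le_mul_of_nonneg_right hp (le_max_right _ _)
        _ = _ := mul_comm _ _

/-! ### Reproducing kernels and Bernstein's inequality -/

/-- Fourier inversion and Fubini again: on the frequency side `K` acts as multiplication by its
symbol, which is `1` wherever `h` contributes. -/
lemma conv_mulKernel {K : Space d → ℂ} (hK : Integrable K) (h : 𝓢(Space d, ℂ)) {l : ℝ}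
    (hl : 0 < l) (H : ∀ ξ, h (l⁻¹ • ξ) ≠ 0 → convSymbol K ξ = 1) :
    conv K (mulKernel h l) = mulKernel h l := by
  ext a
  have i₁ : Integrable fun ξ : Space d => h (l⁻¹ • ξ) :=
    (integrable_comp_smul_iff volume _ (inv_ne_zero hl.ne')).2 h.integrable
  set c : ℂ := (((2 * Real.pi) ^ d : ℝ) : ℂ)⁻¹
  let E : Space d → Space d → ℂ := fun y ξ => Complex.exp (Complex.I * (inner ℝ y ξ : ℝ))
  have e : ∀ y, K y * mulKernel h l (a - y) =
      c * ∫ ξ : Space d, K y * (h (l⁻¹ • ξ) * E (a - y) ξ) := by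
    intro y
    rw [mulKernel_eq h hl, mul_left_comm, ← integral_const_mul]
    simp only [E, mul_comm (h _)]
    rfl
  have hi : Integrable (fun w : Space d × Space d =>
      K w.1 * (h (l⁻¹ • w.2) * E (a - w.1) w.2)) (volume.prod volume) := by
    have := (hK.mul_prod i₁).mul_bdd (c := 1) (g := fun w : Space d × Space d => E (a - w.1) w.2)
      (Continuous.aestronglyMeasurable (by fun_prop))
      (Filter.Eventually.of_forall fun w => (norm_exp_I_mul _).le)
    simpa only [mul_assoc] using this
  rw [conv]
  simp only [e]
  rw [integral_const_mul, integral_integral_swap (μ := volume) (ν := (volume : Measure (Space d)))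
    (f := fun y ξ => K y * (h (l⁻¹ • ξ) * E (a - y) ξ)) hi, mulKernel_eq h hl]
  congr 2
  ext ξ
  have hz : ∀ y, K y * (h (l⁻¹ • ξ) * E (a - y) ξ) =
      h (l⁻¹ • ξ) * E a ξ * (K y * Complex.exp (-(Complex.I * (inner ℝ y ξ : ℝ)))) := by
    intro y
    have : E (a - y) ξ = E a ξ * Complex.exp (-(Complex.I * (inner ℝ y ξ : ℝ))) := by
      simp only [E, ← Complex.exp_add, inner_sub_left]
      congr 1
      push_cast
      ring
    rw [this]
    ring
  simp only [hz, integral_const_mul]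
  change _ * convSymbol K ξ = _
  by_cases h1 : h (l⁻¹ • ξ) = 0
  · simp [h1]
  rw [H ξ h1, mul_one, mul_comm]

lemma conv_conv_eq_self {K M : Space d → ℂ} (hK : Integrable K) (hM : Integrable M)
    (hKM : conv K M = M) (f : SmoothPer d) : conv K (conv M f) = conv M f := by
  ext x
  obtain ⟨C, hC⟩ := exists_bound f
  have hf := continuous_coe f
  have e : ∀ y, K y * conv M f (x - y) =
      ∫ a, K y * M (a - y) * (f : Space d → ℂ) (x - a) := by
    intro y
    rw [conv, ← integral_sub_right_eq_self _ y, ← integral_const_mul]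
    simp only [sub_sub_sub_cancel_right, mul_assoc]
  rw [conv]
  simp only [e]
  have hi : Integrable (fun w : Space d × Space d =>
      K w.2 * M (w.1 - w.2) * (f : Space d → ℂ) (x - w.1)) (volume.prod volume) :=
    (hK.convolution_integrand (ContinuousLinearMap.mul ℂ ℂ) hM).mul_bdd (c := C)
      (Continuous.aestronglyMeasurable (by fun_prop)) (Filter.Eventually.of_forall fun w => hC _)
  rw [integral_integral_swap (f := fun y a => K y * M (a - y) * (f : Space d → ℂ) (x - a)) hi.swap]
  simp only [integral_mul_const]
  conv_rhs => rw [← hKM]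
  rfl

lemma conv_mulKernel_apply (h : 𝓢(Space d, ℂ)) {l : ℝ} (hl : 0 < l) (f : Space d → ℂ)
    (x : Space d) : conv (mulKernel h l) f x =
      ∫ w, (𝓕⁻ h) w * f (x - (2 * Real.pi / l) • w) :=
  integral_mulKernel_mul (fun y z => z * f (x - y))
    (fun _ c z _ => by rw [Complex.real_smul, mul_assoc]) h hl

variable (d) in
/-- A symbol equal to `1` on the ball of radius `8/3`. -/
lemma exists_ball_cutoff : ∃ h : 𝓢(Space d, ℂ), ∀ ζ, ‖ζ‖ ≤ 8 / 3 → h ζ = 1 := by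
  let b : ContDiffBump (0 : Space d) := ⟨8 / 3, 4, by norm_num, by norm_num⟩
  obtain ⟨h, hh⟩ := exists_schwartz_eq (f := fun ζ : Space d => (b ζ : ℂ))
    (Complex.ofRealCLM.contDiff.comp b.contDiff)
    (fun ζ h => by rw [b.zero_of_le_dist (by rwa [dist_zero_right]), Complex.ofReal_zero])
  exact ⟨h, fun ζ hζ => by
    rw [hh, b.one_of_mem_closedBall (mem_closedBall_zero_iff.2 hζ), Complex.ofReal_one]⟩

/-- A block is reproduced by a fixed low-pass kernel rescaled to `2^k`. Integration by parts puts
the derivative on that kernel, at the cost of a factor proportional to `2^k`, and Young's inequality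
concludes. -/
lemma exists_bernstein (P : DyadicPartition d) (v : Space d) : ∃ C : ℝ, 0 ≤ C ∧
    ∀ (p : ℝ≥0∞), 1 ≤ p → ∀ (k : ℤ) (f : SmoothPer d),
      eLpNorm (dirDeriv v (blockPer P k f) : Space d → ℂ) p (volume.restrict (cell d)) ≤
        ENNReal.ofReal (C * (2 : ℝ) ^ k) * eLpNorm (block P k f) p (volume.restrict (cell d)) := by
  obtain ⟨h, hh⟩ := exists_ball_cutoff d
  let ψ : 𝓢(Space d, ℂ) := ∂_{v} (𝓕⁻ h)
  refine ⟨(2 * Real.pi)⁻¹ * ∫ w, ‖ψ w‖,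
    mul_nonneg (by positivity) (integral_nonneg fun _ => norm_nonneg _), fun p hp k f => ?_⟩
  have hl : (0 : ℝ) < 2 ^ k := by positivity
  have hK := integrable_mulKernel h hl
  have hrep : convPer hK (blockPer P k f) = blockPer P k f := by
    obtain ⟨h', l', hl', e, s⟩ := exists_kernel_eq P k
    refine Subtype.ext ?_
    change conv _ (conv (kernel P k) f) = conv (kernel P k) f
    refine conv_conv_eq_self hK (integrable_kernel P k) ?_ f
    rw [e]
    refine conv_mulKernel hK h' hl' fun ξ hξ => ?_
    rw [s, Complex.ofReal_ne_zero] at hξ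
    rw [convSymbol_mulKernel h hl]
    refine hh _ ?_
    rw [norm_smul, norm_inv, Real.norm_of_nonneg hl.le, inv_mul_le_iff₀ hl]
    exact (norm_lt_of_symbol_ne_zero P hξ).le
  -- Presents the differentiated kernel in the form `𝓕⁻ h`, so that it is a `mulKernel` as well.
  have hψ : 𝓕⁻ (𝓕 ψ) = ψ := FourierTransform.fourierInv_fourier_eq ψ
  have key : (dirDeriv v (blockPer P k f) : Space d → ℂ) =
      ((2 : ℝ) ^ k / (2 * Real.pi)) • conv (mulKernel (𝓕 ψ) ((2 : ℝ) ^ k)) (blockPer P k f) := by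
    conv_lhs => rw [← hrep, dirDeriv_convPer]
    ext x
    change conv _ _ x = _
    have := integral_lineDeriv (𝓕⁻ h) (blockPer P k f) v (2 * Real.pi / 2 ^ k) x
    rw [Pi.smul_apply, conv_mulKernel_apply _ hl, conv_mulKernel_apply _ hl, hψ, this,
      Complex.real_smul, ← mul_assoc, ← Complex.ofReal_mul]
    rw [div_mul_div_cancel₀' hl.ne', div_self (by positivity), Complex.ofReal_one, one_mul]
  rw [key, eLpNorm_const_smul, Real.enorm_eq_ofReal (by positivity)]
  refine (mul_le_mul_right (eLpNorm_conv_le hp (integrable_mulKernel _ hl) _) _).trans_eq ?_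
  rw [integral_norm_mulKernel _ hl, hψ, ← mul_assoc, ← ENNReal.ofReal_mul (by positivity)]
  congr 2
  field_simp

lemma exists_gradENorm_blockPer_le (P : DyadicPartition d) : ∃ C : ℝ, 0 ≤ C ∧
    ∀ (p : ℝ≥0∞), 1 ≤ p → ∀ (k : ℤ) (f : SmoothPer d), gradENorm p (blockPer P k f) ≤
        ENNReal.ofReal (C * (2 : ℝ) ^ k) * eLpNorm (block P k f) p (volume.restrict (cell d)) := by
  choose C hC0 hC using fun i : Fin d => exists_bernstein P (EuclideanSpace.single i (1 : ℝ))
  refine ⟨∑ i, C i, Finset.sum_nonneg fun i _ => hC0 i, fun p hp k f => ?_⟩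
  rw [Finset.sum_mul, ENNReal.ofReal_sum_of_nonneg fun i _ => mul_nonneg (hC0 i) (by positivity),
    Finset.sum_mul]
  exact Finset.sum_le_sum fun i _ => hC i p hp k f

/-! ### Estimates in terms of the Besov norms -/

lemma eLpNorm_block_le (P : DyadicPartition d) (α : ℝ) (p : ℝ≥0∞) {k : ℤ} (hk : -1 ≤ k)
    (f : SmoothPer d) : eLpNorm (block P k f) p (volume.restrict (cell d)) ≤
      ENNReal.ofReal ((2 : ℝ) ^ (-(α * k)) * (besovENorm P α p f).toReal) := by
  have h := le_iSup₂ (f := fun (k : ℤ) (_ : -1 ≤ k) => ENNReal.ofReal ((2 : ℝ) ^ (α * k)) *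
      eLpNorm (block P k f) p (volume.restrict (cell d))) k hk
  rw [ENNReal.ofReal_mul (by positivity), ENNReal.ofReal_toReal (besovENorm_lt_top P α p f).ne]
  refine le_trans (le_of_eq ?_) (mul_le_mul_right h _)
  rw [← mul_assoc, ← ENNReal.ofReal_mul (by positivity), ← Real.rpow_add two_pos]
  simp

lemma sum_Ico_rpow_le {a : ℝ} (ha : 0 < a) {k : ℤ} (hk : -1 ≤ k) :
    ∑ j ∈ Finset.Ico (-1) k, (2 : ℝ) ^ (a * j) ≤ ((2 : ℝ) ^ a - 1)⁻¹ * (2 : ℝ) ^ (a * k) := by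
  have h1 : 0 < (2 : ℝ) ^ a - 1 := by linarith [Real.one_lt_rpow one_lt_two ha]
  induction k, hk using Int.leInduction with
  | base =>
    simp only [Finset.Ico_self, Finset.sum_empty]
    positivity
  | succ k hk ih =>
    have e : Finset.Ico (-1) (k + 1) = insert k (Finset.Ico (-1) k) := by
      ext j
      simp only [Finset.mem_Ico, Finset.mem_insert]
      omega
    rw [e, Finset.sum_insert (by simp)]
    push_cast
    rw [mul_add, mul_one, Real.rpow_add two_pos]
    refine (add_le_add_right ih _).trans_eq ?_
    field_simp
    ring

lemma gradENorm_sum_le {ι : Type*} {p : ℝ≥0∞} (hp : 1 ≤ p) (s : Finset ι) (f : ι → SmoothPer d) :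
    gradENorm p (∑ j ∈ s, f j) ≤ ∑ j ∈ s, gradENorm p (f j) := by
  simp only [gradENorm, dirDeriv_sum]
  rw [Finset.sum_comm]
  refine Finset.sum_le_sum fun i _ => ?_
  rw [AddSubmonoidClass.coe_finsetSum]
  exact eLpNorm_sum_le (fun j _ => (continuous_coe _).aestronglyMeasurable) hp

/-- By Bernstein the block `j` contributes `2^{(1-α)j}`. As `α < 1`, this grows geometrically and
the sum is comparable to its upper end. -/
lemma exists_gradENorm_lowPer_le (P : DyadicPartition d) {α : ℝ} (hα : α < 1) : ∃ C : ℝ, 0 ≤ C ∧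
    ∀ (p : ℝ≥0∞), 1 ≤ p → ∀ (k : ℤ) (f : SmoothPer d), -1 ≤ k → gradENorm p (lowPer P k f) ≤
      ENNReal.ofReal (C * (2 : ℝ) ^ ((1 - α) * k) * (besovENorm P α p f).toReal) := by
  obtain ⟨C, hC0, hC⟩ := exists_gradENorm_blockPer_le P
  have h1 : 0 < (2 : ℝ) ^ (1 - α) - 1 := by
    linarith [Real.one_lt_rpow one_lt_two (sub_pos.2 hα)]
  refine ⟨C * ((2 : ℝ) ^ (1 - α) - 1)⁻¹, by positivity, fun p hp k f hk => ?_⟩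
  refine (gradENorm_sum_le hp _ _).trans ?_
  have h2 : ∀ j ∈ Finset.Ico (-1) k, gradENorm p (blockPer P j f) ≤
      ENNReal.ofReal (C * (2 : ℝ) ^ ((1 - α) * j) * (besovENorm P α p f).toReal) := by
    intro j hj
    refine (hC p hp j f).trans ((mul_le_mul_right
      (eLpNorm_block_le P α p (Finset.mem_Ico.1 hj).1 f) _).trans_eq ?_)
    rw [← ENNReal.ofReal_mul (by positivity), sub_mul, one_mul, sub_eq_add_neg,
      Real.rpow_add two_pos, Real.rpow_intCast]
    congr 1
    ring
  refine (Finset.sum_le_sum h2).trans ?_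
  rw [← ENNReal.ofReal_sum_of_nonneg fun i _ => by positivity, ← Finset.sum_mul, ← Finset.mul_sum]
  refine ENNReal.ofReal_le_ofReal (mul_le_mul_of_nonneg_right ?_ ENNReal.toReal_nonneg)
  rw [mul_assoc]
  exact mul_le_mul_of_nonneg_left (sum_Ico_rpow_le (sub_pos.2 hα) hk) hC0

/-! ### The commutator on a single frequency shell -/

/-- The contribution of the index `k` to the commutator. -/
noncomputable def shellCommutator (P : DyadicPartition d) {t : ℝ} (ht : 0 < t) (k : ℤ)
    (f g : SmoothPer d) : SmoothPer d :=
  heatPer ht (mulPer (lowPer P (k - 1) f) (blockPer P k g)) -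
    mulPer (lowPer P (k - 1) f) (blockPer P k (heatPer ht g))

lemma block_heat (P : DyadicPartition d) {t : ℝ} (ht : 0 < t) (k : ℤ) (g : SmoothPer d) :
    block P k (heatPer ht g) = heat t (block P k g) :=
  conv_comm (integrable_kernel P k) (integrable_gauss ht) (continuous_coe g)
    (exists_bound g).choose_spec

lemma conv_sub_kernel {K L f : Space d → ℂ} (hK : Integrable K) (hL : Integrable L)
    (hf : Continuous f) {C : ℝ} (hC : ∀ x, ‖f x‖ ≤ C) (x : Space d) :
    conv (K - L) f x = conv K f x - conv L f x := by
  simp only [conv, Pi.sub_apply, sub_mul]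
  exact integral_sub (integrable_mul_comp_sub hK hf hC x) (integrable_mul_comp_sub hL hf hC x)

lemma convSymbol_sub {K L : Space d → ℂ} (hK : Integrable K) (hL : Integrable L) (ζ : Space d) :
    convSymbol (K - L) ζ = convSymbol K ζ - convSymbol L ζ := by
  have h : ∀ M : Space d → ℂ, Integrable M →
      Integrable fun y => M y * Complex.exp (-(Complex.I * (inner ℝ y ζ : ℝ))) := fun M hM =>
    hM.mul_bdd (c := 1) (Continuous.aestronglyMeasurable (by fun_prop))
      (Filter.Eventually.of_forall fun y => (norm_exp_neg_I_mul _).le)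
  simp only [convSymbol, Pi.sub_apply, sub_mul]
  exact integral_sub (h K hK) (h L hL)

/-- The difference of the Gaussian and the localized kernel has a symbol vanishing on the annulus of
the shell, so it annihilates both the product and the block. -/
lemma shellCommutator_eq (P : DyadicPartition d) {t : ℝ} (ht : 0 < t) {k : ℤ} (hk : 1 ≤ k)
    (f g : SmoothPer d) (h : 𝓢(Space d, ℂ)) (hh : ∀ ζ, 1 / 12 ≤ ‖ζ‖ → ‖ζ‖ ≤ 10 / 3 →
      h ζ = Real.exp (-(t * ((2 : ℝ) ^ k) ^ 2) * ‖ζ‖ ^ 2)) :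
    (shellCommutator P ht k f g : Space d → ℂ) = fun x =>
      conv (mulKernel h ((2 : ℝ) ^ k)) (mulPer (lowPer P (k - 1) f) (blockPer P k g)) x -
        (lowPer P (k - 1) f : Space d → ℂ) x *
          conv (mulKernel h ((2 : ℝ) ^ k)) (blockPer P k g) x := by
  have hl : (0 : ℝ) < 2 ^ k := by positivity
  have hK := integrable_mulKernel h hl
  have hG := integrable_gauss (d := d) ht
  have H : ∀ ζ : Space d, (2 : ℝ) ^ k / 12 ≤ ‖ζ‖ → ‖ζ‖ ≤ (2 : ℝ) ^ k * (10 / 3) →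
      convSymbol (gauss t - mulKernel h ((2 : ℝ) ^ k)) ζ = 0 := by
    intro ζ h1 h2
    have hn : ‖((2 : ℝ) ^ k)⁻¹ • ζ‖ = ((2 : ℝ) ^ k)⁻¹ * ‖ζ‖ := by
      rw [norm_smul, norm_inv, Real.norm_of_nonneg hl.le]
    rw [convSymbol_sub hG hK, convSymbol_gauss ht, convSymbol_mulKernel h hl, hh, hn, sub_eq_zero]
    · congr 2
      field_simp
    · rw [hn, le_inv_mul_iff₀ hl]
      linarith
    · rw [hn, inv_mul_le_iff₀ hl]
      exact h2
  ext x
  have e1 := conv_lowPart_mul_block_eq_zero P (hG.sub hK) hk H f g x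
  have e2 := conv_block_eq_zero P (hG.sub hK) hk H g x
  rw [conv_sub_kernel hG hK (continuous_coe _) (exists_bound _).choose_spec, sub_eq_zero] at e1
  rw [← coe_blockPer, conv_sub_kernel hG hK (continuous_coe _) (exists_bound _).choose_spec,
    sub_eq_zero] at e2
  rw [← e1, ← e2]
  change _ - (lowPer P (k - 1) f : Space d → ℂ) x * block P k (heatPer ht g) x = _
  rw [block_heat]
  rfl

lemma shellCommutator_of_nonpos (P : DyadicPartition d) {t : ℝ} (ht : 0 < t) {k : ℤ} (hk : k ≤ 0)
    (f g : SmoothPer d) : shellCommutator P ht k f g = 0 := by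
  have h0 : ∀ g, mulPer (lowPer P (k - 1) f) g = 0 := fun g => by
    refine Subtype.ext (funext fun x => ?_)
    simp [mulPer, lowPart_of_nonpos P hk]
  rw [shellCommutator, h0, h0, sub_zero]
  refine Subtype.ext (funext fun x => ?_)
  simp [heat]

lemma exists_shellCommutator_le (P : DyadicPartition d) {α β γ : ℝ} (hα : α < 1)
    (hγ : α + β ≤ γ) {p p₁ p₂ : ℝ≥0∞} (hp : 1 ≤ p) (hp₁ : 1 ≤ p₁)
    (hpp : p⁻¹ = p₁⁻¹ + p₂⁻¹) : ∃ C : ℝ, 0 ≤ C ∧ ∀ (t : ℝ) (ht : 0 < t) (k : ℤ) (f g : SmoothPer d),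
      eLpNorm (shellCommutator P ht k f g : Space d → ℂ) p (volume.restrict (cell d)) ≤
        ENNReal.ofReal (C * t ^ ((α + β - γ) / 2) * (2 : ℝ) ^ (-(γ * k)) *
          ((besovENorm P α p₁ f).toReal * (besovENorm P β p₂ g).toReal)) := by
  -- The decay exponent that converts `τ = t4^k` into the required power of `t`; `γ ≥ α + β` makes
  -- it nonnegative.
  obtain ⟨C₁, hC₁0, hC₁⟩ := exists_localized_heat d (N := (γ - α - β) / 2) (by linarith)
  obtain ⟨C₂, hC₂0, hC₂⟩ := exists_gradENorm_lowPer_le P hα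
  -- The factor `2^{-(1-α)}` accounts for the partial sum stopping at `k - 1`.
  refine ⟨2 * Real.pi * C₁ * (C₂ * (2 : ℝ) ^ (-(1 - α))), by positivity,
    fun t ht k f g => ?_⟩
  by_cases hk : k ≤ 0
  · rw [shellCommutator_of_nonpos P ht hk]
    simp
  have hk : 1 ≤ k := by omega
  have hl : (0 : ℝ) < 2 ^ k := by positivity
  obtain ⟨h, hh, hm⟩ := hC₁ (t * ((2 : ℝ) ^ k) ^ 2) (by positivity)
  rw [shellCommutator_eq P ht hk f g h hh]
  refine (eLpNorm_conv_commutator_le hp hp₁ hpp (integrable_mulKernel h hl)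
    (integrable_norm_mul_norm_mulKernel h hl) _ _).trans ?_
  rw [integral_norm_mul_norm_mulKernel h hl]
  set X := (besovENorm P α p₁ f).toReal
  set Y := (besovENorm P β p₂ g).toReal
  have hX : 0 ≤ X := ENNReal.toReal_nonneg
  have hY : 0 ≤ Y := ENNReal.toReal_nonneg
  have b1 : 2 * Real.pi / (2 : ℝ) ^ k * ∫ w, ‖w‖ * ‖(𝓕⁻ h) w‖ ≤ 2 * Real.pi / (2 : ℝ) ^ k *
      (C₁ * (t * ((2 : ℝ) ^ k) ^ 2) ^ (-((γ - α - β) / 2))) :=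
    mul_le_mul_of_nonneg_left hm (by positivity)
  refine (mul_le_mul' (ENNReal.ofReal_le_ofReal b1) (mul_le_mul' (hC₂ p₁ hp₁ (k - 1) f (by omega))
    (eLpNorm_block_le P β p₂ (by omega) g))).trans ?_
  rw [← ENNReal.ofReal_mul (by positivity), ← ENNReal.ofReal_mul (by positivity)]
  refine ENNReal.ofReal_le_ofReal (le_of_eq ?_)
  have hpow : (2 : ℝ) ^ k = (2 : ℝ) ^ (k : ℝ) := (Real.rpow_intCast 2 k).symm
  rw [Real.mul_rpow ht.le (by positivity), hpow, ← Real.rpow_natCast, ← Real.rpow_mul two_pos.le,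
    ← Real.rpow_mul two_pos.le, div_eq_mul_inv, ← Real.rpow_neg two_pos.le]
  have ht' : -((γ - α - β) / 2) = (α + β - γ) / 2 := by ring
  -- Exponents per unit of `k`: `-1` from the moment, `-(γ-α-β)` from the heat decay, `1-α` from the
  -- gradient and `-β` from the block of `g`; they add up to `-γ`.
  have h2 : (2 : ℝ) ^ (-(k : ℝ)) * (2 : ℝ) ^ ((k : ℝ) * (2 : ℕ) * (-((γ - α - β) / 2))) *
      (2 : ℝ) ^ ((1 - α) * ((k - 1 : ℤ) : ℝ)) * (2 : ℝ) ^ (-(β * k)) =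
      (2 : ℝ) ^ (-(1 - α)) * (2 : ℝ) ^ (-(γ * k)) := by
    simp only [← Real.rpow_add two_pos]
    congr 1
    push_cast
    ring
  rw [ht'] at h2 ⊢
  linear_combination (2 * Real.pi * C₁ * C₂ * t ^ ((α + β - γ) / 2) * X * Y) * h2

/-! ### The commutator -/

/-- The paraproduct on smooth periodic functions. -/
noncomputable def paraPer (P : DyadicPartition d) (f g : SmoothPer d) : SmoothPer d :=
  ⟨paraproduct P f g, paraproduct_mem P f g⟩

/-- The commutator on smooth periodic functions. -/
noncomputable def commPer (P : DyadicPartition d) {t : ℝ} (ht : 0 < t) (f g : SmoothPer d) :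
    SmoothPer d :=
  heatPer ht (paraPer P f g) - paraPer P f (heatPer ht g)

lemma coe_commPer (P : DyadicPartition d) {t : ℝ} (ht : 0 < t) (f g : SmoothPer d) :
    (commPer P ht f g : Space d → ℂ) = heatCommutator P t f g := rfl

lemma hasSum_shellCommutator (P : DyadicPartition d) {t : ℝ} (ht : 0 < t) (f g : SmoothPer d)
    (x : Space d) : HasSum (fun k : ℤ => (shellCommutator P ht k f g : Space d → ℂ) x)
      ((commPer P ht f g : Space d → ℂ) x) := by
  obtain ⟨C, hC⟩ := exists_bound_paraproduct P f g
  have h1 := conv_tsum (integrable_gauss ht)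
    (F := fun k => (mulPer (lowPer P (k - 1) f) (blockPer P k g) : Space d → ℂ))
    (fun k => continuous_coe _) (summable_half_pow_natAbs.mul_left C)
    (fun k x => by simpa [mulPer] using hC k x) x
  have h2 := (summable_paraproduct P f (heatPer ht g) x).hasSum
  convert! h1.sub h2 using 1
  · ext k
    simp only [shellCommutator, AddSubgroupClass.coe_sub, Pi.sub_apply, mulPer, coe_lowPer,
      coe_blockPer]
    rfl
  · simp only [mulPer, coe_lowPer, coe_blockPer]
    rfl

lemma exists_bound_shellCommutator (P : DyadicPartition d) {t : ℝ} (ht : 0 < t)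
    (f g : SmoothPer d) : ∃ C, ∀ (k : ℤ) x,
      ‖(shellCommutator P ht k f g : Space d → ℂ) x‖ ≤ C * (1 / 2) ^ k.natAbs := by
  obtain ⟨C, hC⟩ := exists_bound_paraproduct P f g
  obtain ⟨C', hC'⟩ := exists_bound_paraproduct P f (heatPer ht g)
  refine ⟨(∫ y : Space d, ‖gauss t y‖) * C + C', fun k x => ?_⟩
  simp only [shellCommutator, AddSubgroupClass.coe_sub, Pi.sub_apply]
  refine (norm_sub_le _ _).trans ?_
  rw [add_mul, mul_assoc]
  refine add_le_add (norm_conv_le (integrable_gauss ht) (fun x => ?_) x) ?_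
  · simpa [mulPer] using hC k x
  · simpa [mulPer] using hC' k x

/-- The block commutes with the heat flow, so both terms of the shell reduce to products with
spectrum in the annulus at scale `2^k`, which the block `j` does not meet. -/
lemma block_shellCommutator_eq_zero (P : DyadicPartition d) {t : ℝ} (ht : 0 < t) {j k : ℤ}
    (hjk : k ∉ Finset.Icc (j - 2) (j + 4)) (f g : SmoothPer d) (x : Space d) :
    block P j (shellCommutator P ht k f g) x = 0 := by
  by_cases hk : k ≤ 0
  · rw [shellCommutator_of_nonpos P ht hk]
    simp [block]
  have hk : 1 ≤ k := by omega
  have hjk' : j < k - 4 ∨ k + 2 < j := by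
    rw [Finset.mem_Icc] at hjk
    omega
  have e : block P j (shellCommutator P ht k f g) x =
      block P j (heatPer ht (mulPer (lowPer P (k - 1) f) (blockPer P k g))) x -
        block P j (mulPer (lowPer P (k - 1) f) (blockPer P k (heatPer ht g))) x := by
    simp only [block, shellCommutator, AddSubgroupClass.coe_sub, Pi.sub_apply, mul_sub]
    exact integral_sub
      (integrable_mul_comp_sub (integrable_kernel P j) (continuous_coe _)
        (exists_bound _).choose_spec x)
      (integrable_mul_comp_sub (integrable_kernel P j) (continuous_coe _)
        (exists_bound _).choose_spec x)
  rw [e, block_lowPart_mul_block_eq_zero P hk hjk', block_heat,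
    show block P j (mulPer (lowPer P (k - 1) f) (blockPer P k g)) = 0 from
      funext fun x => block_lowPart_mul_block_eq_zero P hk hjk' f g x]
  simp [heat]

lemma block_commPer (P : DyadicPartition d) {t : ℝ} (ht : 0 < t) (j : ℤ) (f g : SmoothPer d) :
    block P j (commPer P ht f g) = ∑ k ∈ Finset.Icc (j - 2) (j + 4),
      block P j (shellCommutator P ht k f g) := by
  ext x
  obtain ⟨C, hC⟩ := exists_bound_shellCommutator P ht f g
  have h := conv_tsum (integrable_kernel P j)
    (F := fun k => (shellCommutator P ht k f g : Space d → ℂ)) (fun k => continuous_coe _)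
    (summable_half_pow_natAbs.mul_left C) hC x
  simp only [(hasSum_shellCommutator P ht f g _).tsum_eq] at h
  rw [Finset.sum_apply]
  exact h.unique (hasSum_sum_of_ne_finset_zero
    fun k hk => block_shellCommutator_eq_zero P ht hk f g x)

lemma exists_integral_norm_kernel_le (P : DyadicPartition d) : ∃ C : ℝ, 0 ≤ C ∧
    ∀ k, ∫ y, ‖kernel P k y‖ ≤ C := by
  refine ⟨max (∫ w, ‖(𝓕⁻ (lowSchwartz P)) w‖) (∫ w, ‖(𝓕⁻ (bumpSchwartz P)) w‖),
    le_max_of_le_left (integral_nonneg fun _ => norm_nonneg _), fun k => ?_⟩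
  by_cases hk : k = -1
  · rw [hk, kernel_neg_one, integral_norm_mulKernel _ one_pos]
    exact le_max_left _ _
  · rw [kernel_of_ne P hk, integral_norm_mulKernel _ (by positivity)]
    exact le_max_right _ _

/-- Seven shells contribute to each block, and `|j - k| ≤ 4` allows `2^{-γk}` to be replaced by
`2^{-γj}` at the cost of `2^{4|γ|}`, whatever the sign of `γ`. -/
lemma exists_besovENorm_commPer_le (P : DyadicPartition d) {α β γ : ℝ} (hα : α < 1)
    (hγ : α + β ≤ γ) {p p₁ p₂ : ℝ≥0∞} (hp : 1 ≤ p) (hp₁ : 1 ≤ p₁)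
    (hpp : p⁻¹ = p₁⁻¹ + p₂⁻¹) : ∃ C : ℝ, 0 ≤ C ∧ ∀ (t : ℝ) (ht : 0 < t) (f g : SmoothPer d),
      (besovENorm P γ p (commPer P ht f g)).toReal ≤ C * t ^ ((α + β - γ) / 2) *
        ((besovENorm P α p₁ f).toReal * (besovENorm P β p₂ g).toReal) := by
  obtain ⟨C₁, hC₁0, hC₁⟩ := exists_integral_norm_kernel_le P
  obtain ⟨C₂, hC₂0, hC₂⟩ := exists_shellCommutator_le P hα hγ hp hp₁ hpp
  refine ⟨7 * C₁ * C₂ * (2 : ℝ) ^ (4 * |γ|), by positivity, fun t ht f g => ?_⟩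
  set X := (besovENorm P α p₁ f).toReal * (besovENorm P β p₂ g).toReal
  have hX : 0 ≤ X := mul_nonneg ENNReal.toReal_nonneg ENNReal.toReal_nonneg
  refine ENNReal.toReal_le_of_le_ofReal (by positivity) (iSup₂_le fun j hj => ?_)
  have hk : ∀ k ∈ Finset.Icc (j - 2) (j + 4),
      eLpNorm (block P j (shellCommutator P ht k f g)) p (volume.restrict (cell d)) ≤
        ENNReal.ofReal (C₁ * (C₂ * t ^ ((α + β - γ) / 2) *
          ((2 : ℝ) ^ (4 * |γ|) * (2 : ℝ) ^ (-(γ * j))) * X)) := by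
    intro k hk
    refine (eLpNorm_conv_le hp (integrable_kernel P j) _).trans ?_
    refine (mul_le_mul' (ENNReal.ofReal_le_ofReal (hC₁ j)) (hC₂ t ht k f g)).trans ?_
    rw [← ENNReal.ofReal_mul hC₁0]
    refine ENNReal.ofReal_le_ofReal (mul_le_mul_of_nonneg_left (mul_le_mul_of_nonneg_right
      (mul_le_mul_of_nonneg_left ?_ (by positivity)) hX) hC₁0)
    rw [← Real.rpow_add two_pos]
    refine Real.rpow_le_rpow_of_exponent_le one_le_two ?_
    have h1 : |(j : ℝ) - k| ≤ 4 := by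
      rw [Finset.mem_Icc] at hk
      have h2 : ((j - 2 : ℤ) : ℝ) ≤ k := by exact_mod_cast hk.1
      have h3 : (k : ℝ) ≤ ((j + 4 : ℤ) : ℝ) := by exact_mod_cast hk.2
      push_cast at h2 h3
      rw [abs_le]
      constructor <;> linarith
    have h2 : γ * (j - k) ≤ |γ| * 4 := (le_abs_self _).trans
      ((abs_mul _ _).trans_le (mul_le_mul_of_nonneg_left h1 (abs_nonneg _)))
    linarith
  rw [block_commPer]
  refine (mul_le_mul_right ((eLpNorm_sum_le
    (fun k _ => (continuous_block P j _).aestronglyMeasurable) hp).trans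
      (Finset.sum_le_sum hk)) _).trans ?_
  rw [Finset.sum_const, Int.card_Icc, show (j + 4 + 1 - (j - 2)).toNat = 7 by omega,
    nsmul_eq_mul, ← ENNReal.ofReal_natCast, ← ENNReal.ofReal_mul (by positivity),
    ← ENNReal.ofReal_mul (by positivity)]
  refine ENNReal.ofReal_le_ofReal (le_of_eq ?_)
  have h1 : (2 : ℝ) ^ (γ * j) * (2 : ℝ) ^ (-(γ * j)) = 1 := by
    rw [← Real.rpow_add two_pos, add_neg_cancel, Real.rpow_zero]
  push_cast
  linear_combination (7 * C₁ * C₂ * t ^ ((α + β - γ) / 2) * (2 : ℝ) ^ (4 * |γ|) * X) * h1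

/-! ### Bilinearity and extension to the Besov spaces -/

lemma convPer_add {K : Space d → ℂ} (hK : Integrable K) (f g : SmoothPer d) :
    convPer hK (f + g) = convPer hK f + convPer hK g := by
  refine Subtype.ext (funext fun x => ?_)
  change ∫ y, K y * ((f : Space d → ℂ) (x - y) + (g : Space d → ℂ) (x - y)) = _
  simp only [mul_add]
  exact integral_add
    (integrable_mul_comp_sub hK (continuous_coe f) (exists_bound _).choose_spec x)
    (integrable_mul_comp_sub hK (continuous_coe g) (exists_bound _).choose_spec x)

lemma convPer_smul {K : Space d → ℂ} (hK : Integrable K) (c : ℂ) (f : SmoothPer d) :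
    convPer hK (c • f) = c • convPer hK f := by
  refine Subtype.ext (funext fun x => ?_)
  change ∫ y, K y * (c * (f : Space d → ℂ) (x - y)) = c * ∫ y, K y * (f : Space d → ℂ) (x - y)
  simp only [← integral_const_mul, mul_left_comm]

lemma lowPart_add (P : DyadicPartition d) (k : ℤ) (f g : SmoothPer d) (x : Space d) :
    lowPart P k ((f + g : SmoothPer d) : Space d → ℂ) x = lowPart P k f x + lowPart P k g x := by
  simp only [lowPart, block_add, Pi.add_apply, Finset.sum_add_distrib]

lemma lowPart_smul (P : DyadicPartition d) (k : ℤ) (c : ℂ) (f : SmoothPer d) (x : Space d) :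
    lowPart P k ((c • f : SmoothPer d) : Space d → ℂ) x = c * lowPart P k f x := by
  simp only [lowPart, block_smul, Pi.smul_apply, smul_eq_mul, Finset.mul_sum]

lemma paraPer_add_left (P : DyadicPartition d) (f f' g : SmoothPer d) :
    paraPer P (f + f') g = paraPer P f g + paraPer P f' g := by
  refine Subtype.ext (funext fun x => ?_)
  change ∑' k : ℤ, _ = _
  simp only [lowPart_add, add_mul]
  exact (summable_paraproduct P f g x).tsum_add (summable_paraproduct P f' g x)

lemma paraPer_add_right (P : DyadicPartition d) (f g g' : SmoothPer d) :
    paraPer P f (g + g') = paraPer P f g + paraPer P f g' := by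
  refine Subtype.ext (funext fun x => ?_)
  change ∑' k : ℤ, _ = _
  simp only [block_add, Pi.add_apply, mul_add]
  exact (summable_paraproduct P f g x).tsum_add (summable_paraproduct P f g' x)

lemma paraPer_smul_left (P : DyadicPartition d) (c : ℂ) (f g : SmoothPer d) :
    paraPer P (c • f) g = c • paraPer P f g := by
  refine Subtype.ext (funext fun x => ?_)
  change ∑' k : ℤ, _ = c * ∑' k : ℤ, _
  simp only [lowPart_smul, mul_assoc, tsum_mul_left]

lemma paraPer_smul_right (P : DyadicPartition d) (c : ℂ) (f g : SmoothPer d) :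
    paraPer P f (c • g) = c • paraPer P f g := by
  refine Subtype.ext (funext fun x => ?_)
  change ∑' k : ℤ, _ = c * ∑' k : ℤ, _
  simp only [block_smul, Pi.smul_apply, smul_eq_mul, mul_left_comm, tsum_mul_left]

/-- The commutator as a bilinear map. -/
noncomputable def commLin (P : DyadicPartition d) {t : ℝ} (ht : 0 < t) :
    SmoothPer d →ₗ[ℂ] SmoothPer d →ₗ[ℂ] SmoothPer d :=
  LinearMap.mk₂ ℂ (commPer P ht)
    (fun f f' g => by
      simp only [commPer, heatPer, paraPer_add_left, convPer_add]
      abel)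
    (fun c f g => by
      simp only [commPer, heatPer, paraPer_smul_left, convPer_smul, smul_sub])
    (fun f g g' => by
      simp only [commPer, heatPer, paraPer_add_right, convPer_add]
      abel)
    (fun c f g => by
      simp only [commPer, heatPer, paraPer_smul_right, convPer_smul, smul_sub])

/-- The extension is made in one variable at a time, with `flip` exchanging the roles; the bound is
a closed condition and passes to the completions by density. -/
lemma exists_completion_extend₂ {𝕜 E F G : Type*} [NontriviallyNormedField 𝕜]
    [SeminormedAddCommGroup E] [NormedSpace 𝕜 E] [SeminormedAddCommGroup F] [NormedSpace 𝕜 F]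
    [NormedAddCommGroup G] [NormedSpace 𝕜 G] [CompleteSpace G] (b : E →ₗ[𝕜] F →ₗ[𝕜] G) {C : ℝ}
    (hb : ∀ x y, ‖b x y‖ ≤ C * ‖x‖ * ‖y‖) :
    ∃ Φ : UniformSpace.Completion E →L[𝕜] UniformSpace.Completion F →L[𝕜] G,
      (∀ (x : E) (y : F), Φ x y = b x y) ∧ ∀ u v, ‖Φ u v‖ ≤ C * ‖u‖ * ‖v‖ := by
  let b₁ : E →L[𝕜] F →L[𝕜] G := LinearMap.mkContinuous₂ b C hb
  let b₂ : F →L[𝕜] UniformSpace.Completion E →L[𝕜] G :=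
    (b₁.extend (UniformSpace.Completion.toComplL : E →L[𝕜] UniformSpace.Completion E)).flip
  let Φ : UniformSpace.Completion E →L[𝕜] UniformSpace.Completion F →L[𝕜] G :=
    (b₂.extend (UniformSpace.Completion.toComplL : F →L[𝕜] UniformSpace.Completion F)).flip
  have hΦ : ∀ (x : E) (y : F), Φ x y = b x y := by
    intro x y
    have h1 := b₂.extend_eq (e := (UniformSpace.Completion.toComplL :
      F →L[𝕜] UniformSpace.Completion F)) UniformSpace.Completion.denseRange_coe
        (UniformSpace.Completion.isUniformInducing_coe F) y
    have h2 := b₁.extend_eq (e := (UniformSpace.Completion.toComplL :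
      E →L[𝕜] UniformSpace.Completion E)) UniformSpace.Completion.denseRange_coe
        (UniformSpace.Completion.isUniformInducing_coe E) x
    have h3 : Φ x y = b₂ y x := congrArg (fun T => T (x : UniformSpace.Completion E)) h1
    have h4 : b₂ y x = b₁ x y := congrArg (fun T => T y) h2
    rw [h3, h4]
    rfl
  refine ⟨Φ, hΦ, fun u v => ?_⟩
  induction u, v using UniformSpace.Completion.induction_on₂ with
  | hp => exact isClosed_le (by fun_prop) (by fun_prop)
  | ih x y =>
    rw [hΦ, UniformSpace.Completion.norm_coe, UniformSpace.Completion.norm_coe]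
    exact hb x y

end TorusBesov

theorem propositionA13 {d : ℕ} (P : DyadicPartition d) (α β γ : ℝ) (hα : α < 1)
    (hγ : α + β ≤ γ) (p p₁ p₂ : ℝ≥0∞) [Fact (1 ≤ p)] [Fact (1 ≤ p₁)] [Fact (1 ≤ p₂)]
    (hp : p⁻¹ = p₁⁻¹ + p₂⁻¹) :
    (∀ f ∈ SmoothPer d, ∀ g ∈ SmoothPer d,
      (∀ x, Summable fun k : ℤ => lowPart P (k - 1) f x * block P k g x) ∧
        paraproduct P f g ∈ SmoothPer d) ∧
    (∀ t : ℝ, 0 < t → ∀ g ∈ SmoothPer d, heat t g ∈ SmoothPer d) ∧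
    ∃ C : ℝ, ∀ t : ℝ, 0 < t →
      ∃ Φ : BesovSpace P α p₁ →L[ℂ] BesovSpace P β p₂ →L[ℂ] BesovSpace P γ p,
        (∀ f g : SmoothPer d, ∃ h : SmoothPer d, (h : Space d → ℂ) = heatCommutator P t f g ∧
          Φ (toBesov P α p₁ f) (toBesov P β p₂ g) = toBesov P γ p h) ∧
        ∀ (u : BesovSpace P α p₁) (v : BesovSpace P β p₂),
          ‖Φ u v‖ ≤ C * t ^ ((α + β - γ) / 2) * ‖u‖ * ‖v‖ := by
  refine ⟨fun f hf g hg => ⟨summable_paraproduct P ⟨f, hf⟩ ⟨g, hg⟩,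
    paraproduct_mem P ⟨f, hf⟩ ⟨g, hg⟩⟩, fun t ht g hg => heat_mem ht ⟨g, hg⟩, ?_⟩
  obtain ⟨C, -, hC⟩ := exists_besovENorm_commPer_le P hα hγ (Fact.out : 1 ≤ p) (Fact.out : 1 ≤ p₁) hp
  refine ⟨C, fun t ht => ?_⟩
  let ι : SmoothBesov P γ p →ₗ[ℂ] BesovSpace P γ p :=
    (UniformSpace.Completion.toComplL :
      SmoothBesov P γ p →L[ℂ] UniformSpace.Completion (SmoothBesov P γ p)).toLinearMap
  -- `SmoothBesov` is definitionally `SmoothPer`, so the bilinear commutator is reused under the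
  -- three different seminorms.
  let c : SmoothBesov P α p₁ →ₗ[ℂ] SmoothBesov P β p₂ →ₗ[ℂ] SmoothBesov P γ p := commLin P ht
  obtain ⟨Φ, hΦ, hb⟩ := exists_completion_extend₂ (c.compr₂ ι) (C := C * t ^ ((α + β - γ) / 2))
    (fun f g => by
      refine (UniformSpace.Completion.norm_coe (c f g)).trans_le ?_
      rw [mul_assoc]
      exact hC t ht f g)
  exact ⟨Φ, fun f g => ⟨commPer P ht f g, coe_commPer P ht f g, hΦ f g⟩, hb⟩
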